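/- Let $L$ be a real vector space with a bilinear form $[\cdot,\cdot]:L\times L\to\mathbb{R}$ such that $\omega(\xi,\xi')=\frac12[\xi,\xi']-\frac12[\xi',\xi]$ is non-degenerate and $L=M+N$, where $M=\{\tau:[\xi,\tau]=0\ \forall\xi\}$ and $N=\{\tau:[\tau,\xi]=0\ \forall\xi\}$. Let $J:L\to L$ be linear with $J^2=-1$ and $\omega(J\cdot,J\cdot)=\omega$, such that $g(\tau,\xi)=2\omega(\tau,J\xi)$ is positive definite and makes $L$ a separable real Hilbert space (of finite or infinite dimension) on which $[\cdot,\cdot]$ is continuous. Put $\{\tau,\xi\}=g(\tau,\xi)+2\mathrm{i}\,\omega(\tau,\xi)$. Let $q:L\to Q=L/M$ be the quotient map, with the quotient norm on $Q$, let $j:Q\to JM\subseteq L$ be the linear section of $q$ with image in $JM$, regard $[\cdot,\cdot]$ also as a map $L\times Q\to\mathbb{R}$, and let $\Omega(\phi,\phi')=g(j\phi,j\phi')-\mathrm{i}[j\phi,\phi']$ on $Q$. For a real Hilbert space $E$ let $\hat E$ be the algebraic dual of the topological dual of $E$, with the $\sigma$-algebra generated by the elements of the topological dual of $E$; continuous linear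 maps $E\to\mathbb{C}$ extend canonically to $\hat E$. Let $\nu_Q$ and $\nu_L$ be the centred Gaussian measures on $\hat Q$ and $\hat L$ under which each continuous linear functional $f$ has variance $\frac12\|f\|^2$, respectively $\|f\|^2$ (formally $\mathrm{d}\nu_Q=e^{-\Re\Omega(\phi,\phi)}\mathrm{d}\phi$ and $\mathrm{d}\nu_L=e^{-\frac12 g(\xi,\xi)}\mathrm{d}\xi$). Let $\mathcal{H}^{\tilde S}=L^2(\hat Q,\nu_Q)$ be the space of reduced Schrödinger wave functions, with the normalized coherent states $$k_\tau(\phi)=\exp\left(\Omega(q\tau,\phi)+\mathrm{i}[\tau,\phi]-\tfrac12\Omega(q\tau,q\tau)-\tfrac{\mathrm{i}}2[\tau,\tau]\right),\qquad \tau\in L.$$ Let $\mathcal{H}^H=H^2(\hat L,\nu_L)$ be the closure in $L^2(\hat L,\nu_L)$ of the square-integrable holomorphic functions of finitely many continuous complex-linear functionals on $(L,J)$. It contains the coherent states $K_\tau(\xi)=\exp(\frac12\{\tau,\xi\})$, and a state $\psi\in\mathcal{H}^H$ has the wave function $\psi(\tau)=\langle K_\tau,\psi\rangle$ on $L$. For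 a continuous linear observable $F:L\to\mathbb{R}$ let $X_F\in L$ be given by $2\omega(\xi,X_F)=F(\xi)$ for all $\xi\in L$, let $F^{\pm}(\xi)=\frac12(F(\xi)\mp\mathrm{i}F(J\xi))$, and let $X_{F^-}=\frac12(X_F-\mathrm{i}JX_F)$. The quantizations of $F$ are $$(\check F\psi)(\phi)=\left(-[X_F,\phi]+\mathrm{i}\,\Omega(qX_F,\phi)\right)\psi(\phi)-\mathrm{i}(D_{qX_F}\psi)(\phi)\quad(\phi\in\hat Q),$$ $$(\check F\psi)(\xi)=F^+(\xi)\psi(\xi)-\mathrm{i}(D_{X_{F^-}}\psi)(\xi)\quad(\xi\in L),$$ with $D$ the directional derivative. Let $\mathcal{H}^{\tilde S,cp}$ (respectively $\mathcal{H}^{H,cp}$) be the complex linear span of all $\check F_1\cdots\check F_nk_\tau$ (respectively $\check F_1\cdots\check F_nK_\tau$) with $n\ge0$, $\tau\in L$ and $F_i:L\to\mathbb{R}$ continuous linear. Then there is a unique isometric isomorphism $\mathcal{B}:\mathcal{H}^{\tilde S}\to\mathcal{H}^H$ with $\mathcal{B}k_\tau=e^{-\frac14 g(\tau,\tau)}K_\tau$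 for all $\tau\in L$. All functions in $\mathcal{H}^{\tilde S,cp}$ and $\mathcal{H}^{H,cp}$ represent elements of $\mathcal{H}^{\tilde S}$ and $\mathcal{H}^H$, and each $\check F$ is a well-defined linear operator on each of these two spaces. Moreover $\mathcal{B}$ restricts to a linear isomorphism $\mathcal{H}^{\tilde S,cp}\to\mathcal{H}^{H,cp}$, and $\mathcal{B}\check F\tilde\psi=\check F\mathcal{B}\tilde\psi$ for every continuous linear $F:L\to\mathbb{R}$ and every $\tilde\psi\in\mathcal{H}^{\tilde S,cp}$. -/

import Mathlib

open MeasureTheory ProbabilityTheory Topology Filter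
open scoped NNReal ENNReal InnerProductSpace

universe u

namespace OecklQuantization
noncomputable section

/-- The algebraic dual of the topological dual of `E`. -/
abbrev Hat (E : Type*) [SeminormedAddCommGroup E] [NormedSpace ℝ E] : Type _ :=
  Module.Dual ℝ (StrongDual ℝ E)

section hat
variable {E : Type*} [SeminormedAddCommGroup E] [NormedSpace ℝ E]

/-- The cylinder `σ`-algebra, i.e. the projective limit of the Borel `σ`-algebras of the
finite-dimensional quotients of `E`. -/
instance instMeasurableSpaceHat : MeasurableSpace (Hat E) :=
  ⨆ f : StrongDual ℝ E, MeasurableSpace.comap (fun x : Hat E => x f) inferInstance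

theorem measurable_eval (f : StrongDual ℝ E) : Measurable (fun x : Hat E => x f) :=
  Measurable.of_comap_le (le_iSup (fun f : StrongDual ℝ E =>
    MeasurableSpace.comap (fun x : Hat E => x f) inferInstance) f)

theorem measurable_toHat {Ω : Type*} [MeasurableSpace Ω] {S : Ω → Hat E}
    (h : ∀ f, Measurable (fun ω => S ω f)) : Measurable S := by
  rw [measurable_iff_comap_le]
  simp only [instMeasurableSpaceHat, MeasurableSpace.comap_iSup, MeasurableSpace.comap_comp]
  exact iSup_le fun f => (h f).comap_le

/-- `ν` is the centred Gaussian measure on `Hat E` whose image under every `f` in the topological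
dual of `E` is normal with variance `v ‖f‖²`.  (These images determine `ν`, as the functionals `f`
generate the `σ`-algebra and form a vector space.)  If `E` is a finite-dimensional Hilbert space, so
that `Hat E = E`, then `ν` has density proportional to `exp (- ‖x‖² / (2 v))`. -/
def IsHatGaussian (ν : Measure (Hat E)) (v : ℝ≥0) : Prop :=
  ∀ f : StrongDual ℝ E, ν.map (fun x : Hat E => x f) = gaussianReal 0 (v * ‖f‖₊ ^ 2)

/-- The canonical inclusion `E → Hat E`. -/
def incl (x : E) : Hat E := ContinuousLinearMap.coeLM ℝ |>.flip x

theorem incl_apply (x : E) (f : StrongDual ℝ E) : incl x f = f x := rfl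

/-- The canonical extension to `Hat E` of a continuous real-linear map `E → ℂ`. -/
def ext (l : E →L[ℝ] ℂ) (x : Hat E) : ℂ :=
  (x (Complex.reCLM.comp l) : ℂ) + (x (Complex.imCLM.comp l) : ℂ) * Complex.I

theorem ext_incl (l : E →L[ℝ] ℂ) (x : E) : ext l (incl x) = l x :=
  Complex.re_add_im (l x)

theorem IsHatGaussian.memLp_exp {ν : Measure (Hat E)} {v : ℝ≥0} (hν : IsHatGaussian ν v)
    (l : E →L[ℝ] ℂ) (c : ℂ) : MemLp (fun x : Hat E => Complex.exp (ext l x + c)) 2 ν := by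
  have hm : Measurable fun x : Hat E => Complex.exp (ext l x + c) := by
    have h1 := measurable_eval (E := E) (Complex.reCLM.comp l)
    have h2 := measurable_eval (E := E) (Complex.imCLM.comp l)
    exact Complex.measurable_exp.comp (((Complex.measurable_ofReal.comp h1).add
      ((Complex.measurable_ofReal.comp h2).mul_const _)).add_const _)
  rw [memLp_two_iff_integrable_sq_norm hm.aestronglyMeasurable]
  have h3 : (fun x : Hat E => ‖Complex.exp (ext l x + c)‖ ^ 2)
      = fun x => Real.exp (2 * c.re) * ((fun y : ℝ => Real.exp (2 * y)) ∘
          fun x : Hat E => x (Complex.reCLM.comp l)) x := by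
    funext x
    rw [Complex.norm_exp, ← Real.exp_nat_mul, Function.comp, ← Real.exp_add]
    congr 1
    simp [ext]
    ring
  rw [h3]
  refine Integrable.const_mul ?_ _
  rw [← integrable_map_measure (by fun_prop) (measurable_eval _).aemeasurable, hν]
  exact integrable_exp_mul_gaussianReal 2

end hat

/-- A Gaussian Hilbert space indexed by the Hilbert space `H`. -/
theorem exists_isonormal (H : Type u) [NormedAddCommGroup H] [InnerProductSpace ℝ H]
    [CompleteSpace H] :
    ∃ (Ω : Type u) (_ : MeasurableSpace Ω) (P : Measure Ω) (_ : IsProbabilityMeasure P)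
      (T : H →ₗᵢ[ℝ] Lp ℝ 2 P), ∀ h, P.map (T h) = gaussianReal 0 (‖h‖₊ ^ 2) := by
  obtain ⟨w, b, -⟩ := exists_hilbertBasis ℝ H
  let P : Measure (w → ℝ) := Measure.infinitePi fun _ => gaussianReal 0 1
  have hmap : ∀ i, P.map (fun ω => ω i) = gaussianReal 0 1 := fun i =>
    Measure.infinitePi_map_eval _ i
  have hind : iIndepFun (fun (i : w) (ω : w → ℝ) => ω i) P :=
    iIndepFun_infinitePi (X := fun _ x => x) (fun _ => measurable_id)
  have hmp : ∀ i : w, MeasurePreserving (fun ω : w → ℝ => ω i) P (gaussianReal 0 1) :=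
    fun i => ⟨measurable_pi_apply i, hmap i⟩
  have hL : ∀ i : w, MemLp (fun ω : w → ℝ => ω i) 2 P := fun i =>
    (memLp_id_gaussianReal 2).comp_measurePreserving (hmp i)
  have hint : ∀ i : w, ∫ ω, ω i ∂P = 0 := fun i => by
    have := integral_map (μ := P) (φ := fun ω => ω i) (measurable_pi_apply i).aemeasurable
      (f := fun x : ℝ => x) (by fun_prop)
    rw [hmap, integral_id_gaussianReal] at this
    exact this.symm
  have hint2 : ∀ i : w, ∫ ω, ω i * ω i ∂P = 1 := fun i => by
    have := integral_map (μ := P) (φ := fun ω => ω i) (measurable_pi_apply i).aemeasurable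
      (f := fun x : ℝ => x * x) (by fun_prop)
    rw [hmap] at this
    rw [← this]
    have hv := variance_fun_id_gaussianReal (μ := 0) (v := 1)
    rw [variance_eq_integral (by fun_prop)] at hv
    simpa [pow_two] using hv
  let X : w → Lp ℝ 2 P := fun i => (hL i).toLp
  have hX : ∀ i, X i =ᵐ[P] fun ω => ω i := fun i => (hL i).coeFn_toLp
  have horth : Orthonormal ℝ X := by
    classical
    rw [orthonormal_iff_ite]
    intro i j
    have : ⟪X i, X j⟫_ℝ = ∫ ω, ω j * ω i ∂P := by
      rw [L2.inner_def]
      refine integral_congr_ae ?_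
      filter_upwards [hX i, hX j] with ω h1 h2
      simp [h1, h2]
    rw [this]
    split_ifs with h
    · subst h; exact hint2 i
    · have := (hind.indepFun (Ne.symm h)).integral_fun_mul_eq_mul_integral
        (measurable_pi_apply _).aestronglyMeasurable (measurable_pi_apply _).aestronglyMeasurable
      rw [this, hint, zero_mul]
  let T : H →ₗᵢ[ℝ] Lp ℝ 2 P :=
    horth.orthogonalFamily.linearIsometry.comp b.repr.toLinearIsometry
  refine ⟨w → ℝ, inferInstance, P, inferInstance, T, fun h => ?_⟩
  -- partial sums
  let a : w → ℝ := fun i => b.repr h i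
  have hsum : HasSum (fun i => a i • X i) (T h) :=
    horth.orthogonalFamily.hasSum_linearIsometry (b.repr h)
  have hsq : HasSum (fun i => a i ^ 2) (‖h‖ ^ 2) := by
    have := lp.hasSum_inner (𝕜 := ℝ) (b.repr h) (b.repr h)
    rw [real_inner_self_eq_norm_sq, b.repr.norm_map] at this
    simpa [a, pow_two] using this
  have : IsProbabilityMeasure (P.map (T h)) :=
    Measure.isProbabilityMeasure_map (Lp.aestronglyMeasurable _).aemeasurable
  refine Measure.ext_of_charFun (funext fun t => ?_)
  -- continuity of u ↦ E exp(i t u) on L²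
  let Φ : Lp ℝ 2 P → ℂ := fun u => ∫ ω, Complex.exp (t * u ω * Complex.I) ∂P
  have hΦ : ∀ u : Lp ℝ 2 P, charFun (P.map u) t = Φ u := fun u => by
    rw [charFun_apply_real, integral_map (Lp.aestronglyMeasurable _).aemeasurable (by fun_prop)]
  have hlip : ∀ u u' : Lp ℝ 2 P, ‖Φ u - Φ u'‖ ≤ |t| * ‖u - u'‖ := fun u u' => by
    have hi : ∀ u : Lp ℝ 2 P, Integrable (fun ω => Complex.exp (t * u ω * Complex.I)) P := by
      intro u
      refine Integrable.of_bound (C := 1) ?_ (ae_of_all _ fun ω => ?_)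
      · have := Lp.aestronglyMeasurable u
        exact Continuous.comp_aestronglyMeasurable (g := fun x : ℝ =>
          Complex.exp (t * x * Complex.I)) (by fun_prop) this
      · rw [← Complex.ofReal_mul, Complex.norm_exp_ofReal_mul_I]
    have hm : MemLp (u - u' : Lp ℝ 2 P) 1 P := (Lp.memLp (u - u')).mono_exponent (by norm_num)
    calc ‖Φ u - Φ u'‖ = ‖∫ ω, (Complex.exp (t * u ω * Complex.I)
            - Complex.exp (t * u' ω * Complex.I)) ∂P‖ := by
          rw [integral_sub (hi u) (hi u')]
      _ ≤ ∫ ω, |t| * ‖(u - u' : Lp ℝ 2 P) ω‖ ∂P := by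
          refine norm_integral_le_of_norm_le (hm.integrable le_rfl |>.norm.const_mul _) ?_
          filter_upwards [Lp.coeFn_sub u u'] with ω hω
          have h1 := Real.norm_exp_I_mul_ofReal_sub_one_le (x := t * (u ω - u' ω))
          have h2 : Complex.exp (t * u ω * Complex.I) - Complex.exp (t * u' ω * Complex.I)
              = Complex.exp ((t * u' ω : ℝ) * Complex.I) *
                (Complex.exp (Complex.I * ((t * (u ω - u' ω) : ℝ))) - 1) := by
            rw [mul_sub, mul_one, ← Complex.exp_add]
            push_cast
            ring_nf
          rw [h2, norm_mul, Complex.norm_exp_ofReal_mul_I, one_mul, hω]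
          simpa [abs_mul] using h1
      _ = |t| * ∫ ω, ‖(u - u' : Lp ℝ 2 P) ω‖ ∂P := integral_const_mul _ _
      _ ≤ |t| * ‖u - u'‖ := by
          gcongr
          rw [Lp.norm_def, integral_norm_eq_lintegral_enorm hm.1, ← eLpNorm_one_eq_lintegral_enorm]
          exact ENNReal.toReal_mono (Lp.memLp _).2.ne
            (eLpNorm_le_eLpNorm_of_exponent_le (by norm_num) hm.1)
  have hcont : Continuous Φ :=
    continuous_iff_continuousAt.2 fun u => by
      rw [ContinuousAt, tendsto_iff_norm_sub_tendsto_zero]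
      refine squeeze_zero (fun _ => norm_nonneg _) (fun u' => hlip u' u) ?_
      have : Tendsto (fun u' : Lp ℝ 2 P => |t| * ‖u' - u‖) (𝓝 u) (𝓝 (|t| * ‖u - u‖)) :=
        (Continuous.tendsto (by fun_prop) u)
      simpa using this
  have hfin : ∀ s : Finset w, Φ (∑ i ∈ s, a i • X i)
      = Complex.exp (((-(t ^ 2 / 2) * ∑ i ∈ s, a i ^ 2 : ℝ) : ℂ)) := fun s => by
    rw [← hΦ]
    have h1 : P.map (∑ i ∈ s, a i • X i : Lp ℝ 2 P)
        = P.map (∑ i ∈ s, fun ω : w → ℝ => a i * ω i) := by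
      refine Measure.map_congr ?_
      refine (Lp.coeFn_finsetSum s (fun i => a i • X i)).trans ?_
      refine eventuallyEq_sum fun i _ => ?_
      filter_upwards [Lp.coeFn_smul (a i) (X i), hX i] with ω h1 h2
      simp [h1, h2]
    have h2 : iIndepFun (fun (i : w) (ω : w → ℝ) => a i * ω i) P :=
      iIndepFun_infinitePi (X := fun i x => a i * x) (fun _ => by fun_prop)
    have hmi : ∀ i : w, Measurable fun ω : w → ℝ => a i * ω i := fun i =>
      Measurable.mul (f := fun _ : w → ℝ => a i) measurable_const (measurable_pi_apply i)
    rw [h1, iIndepFun.charFun_map_finsetSum_eq_prod 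
      (fun i _ => (hmi i).aemeasurable) (h2.restrict s)]
    have h3 : ∀ i, P.map (fun ω : w → ℝ => a i * ω i)
        = gaussianReal 0 (NNReal.mk (a i ^ 2) (sq_nonneg _)) := fun i => by
      have := Measure.map_map (μ := P) (g := fun x : ℝ => a i * x) (f := fun ω => ω i)
        (by fun_prop) (by fun_prop)
      rw [hmap, gaussianReal_map_const_mul] at this
      simpa [Function.comp_def] using this.symm
    simp only [h3, Finset.prod_apply, charFun_gaussianReal]
    rw [← Complex.exp_sum]
    congr 1
    push_cast
    rw [Finset.mul_sum]
    refine Finset.sum_congr rfl fun i _ => ?_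
    simp
    ring
  have l1 : Tendsto (fun s : Finset w => Φ (∑ i ∈ s, a i • X i)) atTop (𝓝 (Φ (T h))) :=
    (hcont.tendsto _).comp hsum
  have l2 : Tendsto (fun s : Finset w => Φ (∑ i ∈ s, a i • X i)) atTop
      (𝓝 (Complex.exp ((-(t ^ 2 / 2) * ‖h‖ ^ 2 : ℝ) : ℂ))) := by
    simp only [hfin]
    have hc : Continuous fun x : ℝ => Complex.exp ((-(t ^ 2 / 2) * x : ℝ) : ℂ) := by fun_prop
    exact (hc.tendsto _).comp hsq
  rw [hΦ, tendsto_nhds_unique l1 l2, charFun_gaussianReal]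
  congr 1
  push_cast
  simp
  ring

theorem exists_isHatGaussian {E H : Type*} [SeminormedAddCommGroup E] [NormedSpace ℝ E]
    [NormedAddCommGroup H] [InnerProductSpace ℝ H] [CompleteSpace H]
    (A : StrongDual ℝ E →ₗᵢ[ℝ] H) (v : ℝ≥0) :
    ∃ ν : Measure (Hat E), IsHatGaussian ν v := by
  obtain ⟨Ω, _, P, _, T, hT⟩ := exists_isonormal H
  let b := Module.Basis.ofVectorSpace ℝ (StrongDual ℝ E)
  have hm : ∀ u : Lp ℝ 2 P, ∃ g : Ω → ℝ, Measurable g ∧ u =ᵐ[P] g := fun u =>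
    ⟨_, (Lp.aestronglyMeasurable u).stronglyMeasurable_mk.measurable,
      (Lp.aestronglyMeasurable u).ae_eq_mk⟩
  choose g hg1 hg2 using hm
  let S : Ω → Hat E := fun ω => b.constr ℝ fun k => g (T (A (b k))) ω
  have hS : ∀ f ω, S ω f = (b.repr f).sum fun k c => c * g (T (A (b k))) ω := fun f ω => by
    simp [S, Module.Basis.constr_apply]
  have hSm : Measurable S := measurable_toHat fun f => by
    simp only [hS, Finsupp.sum]
    exact Finset.measurable_sum _ fun k _ => (hg1 _).const_mul _
  have hSf : ∀ f, (fun ω => S ω f) =ᵐ[P] T (A f) := fun f => by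
    have h1 : T (A f) = ∑ k ∈ (b.repr f).support, (b.repr f k) • T (A (b k)) := by
      conv_lhs => rw [← b.linearCombination_repr f]
      simp [Finsupp.linearCombination_apply, Finsupp.sum]
    rw [h1]
    refine EventuallyEq.trans ?_ (Lp.coeFn_finsetSum _ _).symm
    have h2 : (fun ω => S ω f)
        = ∑ k ∈ (b.repr f).support, fun ω => b.repr f k * g (T (A (b k))) ω := by
      ext ω; simp [hS, Finsupp.sum]
    rw [h2]
    refine eventuallyEq_sum fun i _ => ?_
    filter_upwards [Lp.coeFn_smul (b.repr f i) (T (A (b i))), hg2 (T (A (b i)))] with ω h1 h2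
    simp [h1, h2]
  refine ⟨P.map fun ω => (NNReal.sqrt v : ℝ) • S ω, fun f => ?_⟩
  have hm2 : Measurable fun ω => (NNReal.sqrt v : ℝ) • S ω := measurable_toHat fun f => by
    simpa using ((measurable_eval f).comp hSm).const_mul _
  rw [Measure.map_map (measurable_eval f) hm2]
  have : ((fun x : Hat E => x f) ∘ fun ω => (NNReal.sqrt v : ℝ) • S ω)
      = (fun x => (NNReal.sqrt v : ℝ) * x) ∘ fun ω => S ω f := by
    ext ω; simp
  rw [this, ← Measure.map_map (measurable_const_mul _)
      (show Measurable fun ω => S ω f from (measurable_eval f).comp hSm),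
    Measure.map_congr (hSf f), hT, gaussianReal_map_const_mul, A.nnnorm_map]
  congr 1
  · simp
  · ext; simp

variable {L : Type*} [NormedAddCommGroup L] [InnerProductSpace ℝ L]

/-- A linear field theory: the real vector space `L` of solutions, the symplectic potential
`[·,·]` and a compatible complex structure `J`.  The form `g(τ, ξ) = 2 ω(τ, J ξ)` is the inner
product of `L`, where `ω(ξ, ξ') = ([ξ, ξ'] - [ξ', ξ]) / 2` is the symplectic form. -/
structure FieldTheory (L : Type*) [NormedAddCommGroup L] [InnerProductSpace ℝ L] where
  bracket : L →L[ℝ] L →L[ℝ] ℝ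
  J : L →ₗ[ℝ] L
  nondegenerate : ∀ τ, (∀ ξ, 1 / 2 * bracket τ ξ - 1 / 2 * bracket ξ τ = 0) → τ = 0
  /-- `L` is the sum of the subspaces `M` and `N`. -/
  decomposition : ∀ ξ, ∃ m n, (∀ ζ, bracket ζ m = 0) ∧ (∀ ζ, bracket n ζ = 0) ∧ m + n = ξ
  J_sq : ∀ ξ, J (J ξ) = -ξ
  J_symplectic : ∀ τ ξ, 1 / 2 * bracket (J τ) (J ξ) - 1 / 2 * bracket (J ξ) (J τ)
    = 1 / 2 * bracket τ ξ - 1 / 2 * bracket ξ τ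
  inner_eq : ∀ τ ξ, ⟪τ, ξ⟫_ℝ = 2 * (1 / 2 * bracket τ (J ξ) - 1 / 2 * bracket (J ξ) τ)

namespace FieldTheory

variable (T : FieldTheory L)

/-- The symplectic form. -/
def omega (τ : L) : L →L[ℝ] ℝ := (1 / 2 : ℝ) • T.bracket τ - (1 / 2 : ℝ) • T.bracket.flip τ

theorem omega_apply (τ ξ : L) :
    T.omega τ ξ = 1 / 2 * T.bracket τ ξ - 1 / 2 * T.bracket ξ τ := by
  simp [omega]

theorem omega_swap (τ ξ : L) : T.omega τ ξ = -T.omega ξ τ := by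
  simp only [omega_apply]; ring

theorem omega_J_J (τ ξ : L) : T.omega (T.J τ) (T.J ξ) = T.omega τ ξ := by
  simp only [omega_apply, T.J_symplectic]

theorem inner_eq_omega (τ ξ : L) : ⟪τ, ξ⟫_ℝ = 2 * T.omega τ (T.J ξ) := by
  rw [T.inner_eq, omega_apply]

/-- The hermitian inner product `{τ, ξ} = g(τ, ξ) + 2 i ω(τ, ξ)`. -/
def herm (τ : L) : L →L[ℝ] ℂ :=
  Complex.ofRealCLM.comp (innerSL ℝ τ) + (2 * Complex.I) • Complex.ofRealCLM.comp (T.omega τ)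

theorem herm_apply (τ ξ : L) : T.herm τ ξ = (⟪τ, ξ⟫_ℝ : ℂ) + 2 * Complex.I * T.omega τ ξ := by
  simp [herm]

/-- The subspace `M = {τ | [ξ, τ] = 0 for all ξ}` of momentum directions. -/
def M : Submodule ℝ L where
  carrier := {τ | ∀ ξ, T.bracket ξ τ = 0}
  add_mem' ha hb ξ := by simp [ha ξ, hb ξ]
  zero_mem' ξ := by simp
  smul_mem' c a ha ξ := by simp [ha ξ]

theorem mem_M {τ : L} : τ ∈ T.M ↔ ∀ ξ, T.bracket ξ τ = 0 := Iff.rfl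

theorem isClosed_M : IsClosed (T.M : Set L) := by
  have : (T.M : Set L) = ⋂ ξ, {τ | T.bracket ξ τ = 0} := by ext; simp [mem_M]
  rw [this]
  exact isClosed_iInter fun ξ => isClosed_eq (by fun_prop) continuous_const

/-- The space `Q = L / M` of field configurations, with the quotient norm. -/
abbrev Q : Type _ := L ⧸ T.M

/-- The quotient map `L → Q`. -/
abbrev q (ξ : L) : T.Q := T.M.mkQ ξ

/-- The symplectic potential as a map `L × Q → ℝ`. -/
def bracketQ (ξ : L) : T.Q →L[ℝ] ℝ :=
  T.M.liftQL (T.bracket ξ) fun _ hm => T.mem_M.1 hm ξ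

theorem bracketQ_q (ξ τ : L) : T.bracketQ ξ (T.q τ) = T.bracket ξ τ := rfl

/-- The subspace `J M`. -/
def JM : Submodule ℝ L := T.M.map T.J

theorem mem_M_of_omega {ξ : L} (h : ∀ m ∈ T.M, T.omega m ξ = 0) : ξ ∈ T.M := by
  obtain ⟨m, n, hm, hn, rfl⟩ := T.decomposition ξ
  have hn0 : n = 0 := by
    refine T.nondegenerate n fun ζ => ?_
    obtain ⟨m', n', hm', hn', rfl⟩ := T.decomposition ζ
    have := h m' hm'
    simp only [omega_apply, map_add, hm, hm', hn, add_apply] at this ⊢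
    simp [hn'] at this ⊢
    linarith
  rw [hn0, add_zero]
  exact hm

theorem JM_eq : T.JM = T.Mᗮ := by
  ext ξ
  rw [Submodule.mem_orthogonal]
  constructor
  · rintro ⟨m, hm, rfl⟩ m' hm'
    rw [T.inner_eq_omega, T.J_sq, map_neg, T.omega_apply, hm m', hm' m]
    simp
  · intro h
    refine ⟨-T.J ξ, T.M.neg_mem (T.mem_M_of_omega fun m hm => ?_), by simp [T.J_sq]⟩
    have := h m hm
    rw [T.inner_eq_omega] at this
    linarith

theorem herm_J (τ ξ : L) : T.herm τ (T.J ξ) = Complex.I * T.herm τ ξ := by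
  have h1 := T.inner_eq_omega τ (T.J ξ)
  have h2 := T.inner_eq_omega τ ξ
  rw [T.J_sq, map_neg] at h1
  rw [herm_apply, herm_apply, h1, h2]
  push_cast
  linear_combination (2 * (T.omega τ ξ : ℂ)) * Complex.I_sq.symm

variable [CompleteSpace L]

theorem isCompl_M_JM : IsCompl T.M T.JM := by
  have : CompleteSpace T.M := T.isClosed_M.completeSpace_coe
  rw [JM_eq]
  exact T.M.isCompl_orthogonal

/-- The unique linear map `j : Q → L` with `q ∘ j = id` and `j(Q) ⊆ J M`. -/
def jLin : T.Q →ₗ[ℝ] L := T.JM.subtype ∘ₗ (T.M.quotientEquivOfIsCompl T.JM T.isCompl_M_JM).toLinearMap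

theorem jLin_mem (φ : T.Q) : T.jLin φ ∈ T.JM := Subtype.property _

theorem q_jLin (φ : T.Q) : T.q (T.jLin φ) = φ :=
  Submodule.mk_quotientEquivOfIsCompl_apply T.isCompl_M_JM φ

theorem jLin_q_sub_mem (ξ : L) : ξ - T.jLin (T.q ξ) ∈ T.M :=
  (Submodule.Quotient.eq _).1 (T.q_jLin (T.q ξ)).symm

theorem norm_jLin_q_le (ξ : L) : ‖T.jLin (T.q ξ)‖ ≤ ‖ξ‖ := by
  have h1 : ⟪ξ - T.jLin (T.q ξ), T.jLin (T.q ξ)⟫_ℝ = 0 := by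
    have h := T.jLin_mem (T.q ξ)
    rw [JM_eq, Submodule.mem_orthogonal] at h
    exact h _ (T.jLin_q_sub_mem ξ)
  have h2 := norm_add_sq_eq_norm_sq_add_norm_sq_of_inner_eq_zero _ _ h1
  rw [sub_add_cancel] at h2
  nlinarith [norm_nonneg ξ, norm_nonneg (T.jLin (T.q ξ)),
    mul_self_nonneg ‖ξ - T.jLin (T.q ξ)‖]

theorem norm_jLin_le (φ : T.Q) : ‖T.jLin φ‖ ≤ ‖φ‖ := by
  refine le_of_forall_pos_le_add fun ε hε => ?_
  obtain ⟨m, rfl, hm⟩ := Submodule.Quotient.norm_mk_lt φ hε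
  exact (T.norm_jLin_q_le m).trans hm.le

/-- The map `j` as a continuous linear map. -/
def j : T.Q →L[ℝ] L := T.jLin.mkContinuous 1 fun φ => by simpa using T.norm_jLin_le φ

theorem norm_j (φ : T.Q) : ‖T.j φ‖ = ‖φ‖ := by
  refine le_antisymm (T.norm_jLin_le φ) ?_
  conv_lhs => rw [← T.q_jLin φ]
  exact Submodule.Quotient.norm_mk_le (S := T.M) (T.jLin φ)

/-- The symmetric bilinear form `Ω(φ, φ') = g(j φ, j φ') - i [j φ, φ']` on `Q`. -/
def Omega (φ : T.Q) : T.Q →L[ℝ] ℂ :=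
  Complex.ofRealCLM.comp ((innerSL ℝ (T.j φ)).comp T.j)
    - Complex.I • Complex.ofRealCLM.comp (T.bracketQ (T.j φ))

theorem Omega_apply (φ φ' : T.Q) :
    T.Omega φ φ' = (⟪T.j φ, T.j φ'⟫_ℝ : ℂ) - Complex.I * T.bracketQ (T.j φ) φ' := by
  simp [Omega]

/-- Pulling back along `q` embeds the dual of `Q` isometrically into the Hilbert space `L`. -/
def dualEmbedding : StrongDual ℝ T.Q →ₗᵢ[ℝ] L where
  toFun f := (InnerProductSpace.toDual ℝ L).symm (f.comp T.M.mkQL)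
  map_add' f f' := by rw [ContinuousLinearMap.add_comp, map_add]
  map_smul' c f := by rw [ContinuousLinearMap.smul_comp, map_smulₛₗ]; rfl
  norm_map' f := by
    change ‖(InnerProductSpace.toDual ℝ L).symm (f.comp T.M.mkQL)‖ = ‖f‖
    rw [LinearIsometryEquiv.norm_map]
    refine le_antisymm ?_ ?_
    · refine ContinuousLinearMap.opNorm_le_bound _ (norm_nonneg f) fun ξ => ?_
      refine (f.le_opNorm _).trans ?_
      gcongr
      exact Submodule.Quotient.norm_mk_le (S := T.M) ξ
    · refine ContinuousLinearMap.opNorm_le_bound _ (norm_nonneg _) fun φ => ?_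
      have h : f φ = (f.comp T.M.mkQL) (T.jLin φ) := congrArg f (T.q_jLin φ).symm
      rw [h]
      refine (ContinuousLinearMap.le_opNorm _ _).trans ?_
      gcongr
      exact T.norm_jLin_le φ

/-- The Gaussian measure `dν_Q = exp (- Re Ω(φ, φ)) dμ_Q` on `Hat Q`. -/
def nuQ : Measure (Hat T.Q) := (exists_isHatGaussian T.dualEmbedding (1 / 2)).choose

theorem isHatGaussian_nuQ : IsHatGaussian T.nuQ (1 / 2) :=
  (exists_isHatGaussian T.dualEmbedding (1 / 2)).choose_spec

/-- The Gaussian measure `dν_L = exp (- g(ξ, ξ) / 2) dμ_L` on `Hat L`. -/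
def nuL (_T : FieldTheory L) : Measure (Hat L) := (exists_isHatGaussian
  (InnerProductSpace.toDual ℝ L).symm.toLinearIsometry 1).choose

theorem isHatGaussian_nuL : IsHatGaussian T.nuL 1 :=
  (exists_isHatGaussian (InnerProductSpace.toDual ℝ L).symm.toLinearIsometry 1).choose_spec

/-- The Hilbert space `L²(Hat Q, ν_Q)` of reduced Schrödinger wave functions. -/
abbrev HS : Type _ := Lp ℂ 2 T.nuQ

/-- The reduced Schrödinger wave function `k_τ` of the normalized coherent state of `τ`:
`k_τ(φ) = exp (Ω(q τ, φ) + i [τ, φ] - Ω(q τ, q τ) / 2 - i [τ, τ] / 2)`. -/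
def schrCoherent (τ : L) (φ : Hat T.Q) : ℂ :=
  Complex.exp (ext (T.Omega (T.q τ) + Complex.I • Complex.ofRealCLM.comp (T.bracketQ τ)) φ
    + (-(1 / 2) * T.Omega (T.q τ) (T.q τ) - Complex.I / 2 * T.bracket τ τ))

/-- The element of `L²(Hat Q, ν_Q)` given by `k_τ`. -/
def schrCoherentState (τ : L) : T.HS := (T.isHatGaussian_nuQ.memLp_exp
  (T.Omega (T.q τ) + Complex.I • Complex.ofRealCLM.comp (T.bracketQ τ))
  (-(1 / 2) * T.Omega (T.q τ) (T.q τ) - Complex.I / 2 * T.bracket τ τ)).toLp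

/-- Holomorphic functions on `Hat L` that are induced from a finite-dimensional complex quotient
of `(L, J)`: holomorphic functions of finitely many continuous complex-linear functionals. -/
def IsCylHolomorphic (ψ : Hat L → ℂ) : Prop :=
  ∃ (n : ℕ) (l : Fin n → L →L[ℝ] ℂ) (h : (Fin n → ℂ) → ℂ),
    (∀ i ξ, l i (T.J ξ) = Complex.I * l i ξ) ∧ Differentiable ℂ h ∧
      ψ = fun x => h fun i => ext (l i) x

/-- The Hilbert space `H²(Hat L, ν_L)` of square-integrable holomorphic functions: the closure in
`L²(Hat L, ν_L)` of the square-integrable cylindrical holomorphic functions. -/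
def HH : Submodule ℂ (Lp ℂ 2 T.nuL) :=
  (Submodule.span ℂ {u : Lp ℂ 2 T.nuL | ∃ ψ, T.IsCylHolomorphic ψ ∧ u =ᵐ[T.nuL] ψ}).topologicalClosure

/-- The wave function `K_τ(ξ) = exp ({τ, ξ} / 2)` on `L` of the coherent state of `τ`. -/
def holCoherent (τ ξ : L) : ℂ := Complex.exp (1 / 2 * T.herm τ ξ)

/-- The extension of `K_τ` to `Hat L`, as an element of `L²(Hat L, ν_L)`. -/
def holCoherentLp (τ : L) : Lp ℂ 2 T.nuL :=
  (T.isHatGaussian_nuL.memLp_exp ((1 / 2 : ℂ) • T.herm τ) 0).toLp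

theorem holCoherentLp_mem (τ : L) : T.holCoherentLp τ ∈ T.HH := by
  refine Submodule.le_topologicalClosure _ (Submodule.subset_span
    ⟨_, ⟨1, fun _ => (1 / 2 : ℂ) • T.herm τ, fun z => Complex.exp (z 0), ?_, by fun_prop, rfl⟩, ?_⟩)
  · intro _ ξ
    simp only [FunLike.coe_smul, Pi.smul_apply, smul_eq_mul, herm_J]
    ring
  · refine (MemLp.coeFn_toLp _).trans (ae_of_all _ fun x => ?_)
    simp

/-- The coherent state `K_τ` in the holomorphic representation. -/
def holCoherentState (τ : L) : T.HH := ⟨T.holCoherentLp τ, T.holCoherentLp_mem τ⟩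

/-- The normalized coherent state `exp (- g(τ, τ) / 4) K_τ`. -/
def holNormalizedState (τ : L) : T.HH :=
  Complex.exp (-(1 / 4) * (⟪τ, τ⟫_ℝ : ℂ)) • T.holCoherentState τ

/-- The wave function on `L` of a state in the holomorphic representation.  By the reproducing
property of the coherent states its value at `τ` is the inner product with `K_τ`. -/
def wave : T.HH →ₗ[ℂ] (L → ℂ) :=
  LinearMap.pi fun τ => (innerSL ℂ (T.holCoherentState τ)).toLinearMap

theorem wave_apply (u : T.HH) (τ : L) : T.wave u τ = ⟪T.holCoherentState τ, u⟫_ℂ := rfl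

/-- The Hamiltonian vector field of a continuous linear observable `F`: the `X_F ∈ L` with
`2 ω(ξ, X_F) = F ξ` for all `ξ`. -/
def ham (F : StrongDual ℝ L) : L := T.J ((InnerProductSpace.toDual ℝ L).symm F)

theorem two_mul_omega_ham (F : StrongDual ℝ L) (ξ : L) : 2 * T.omega ξ (T.ham F) = F ξ := by
  rw [ham, ← T.inner_eq_omega, real_inner_comm, InnerProductSpace.toDual_symm_apply]

/-- Quantization of `F` on reduced Schrödinger wave functions:
`(F̌ ψ)(φ) = (- [X_F, φ] + i Ω(q X_F, φ)) ψ(φ) - i (D_{X_F} ψ)(φ)`. -/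
def schrQuant (F : StrongDual ℝ L) (ψ : Hat T.Q → ℂ) (φ : Hat T.Q) : ℂ :=
  ext (-Complex.ofRealCLM.comp (T.bracketQ (T.ham F)) + Complex.I • T.Omega (T.q (T.ham F))) φ
      * ψ φ
    - Complex.I * lineDeriv ℝ ψ φ (incl (T.q (T.ham F)))

/-- The holomorphic part `F⁺(ξ) = (F ξ - i F (J ξ)) / 2`. -/
def holPart (F : StrongDual ℝ L) (ξ : L) : ℂ := 1 / 2 * (F ξ - Complex.I * F (T.J ξ))

/-- The anti-holomorphic part `F⁻(ξ) = (F ξ + i F (J ξ)) / 2`. -/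
def antiholPart (F : StrongDual ℝ L) (ξ : L) : ℂ := 1 / 2 * (F ξ + Complex.I * F (T.J ξ))

/-- The Hamiltonian vector field of `F⁻` is `(X_F - i J X_F) / 2`. -/
theorem two_mul_omega_antihol (F : StrongDual ℝ L) (ξ : L) :
    2 * (1 / 2 * ((T.omega ξ (T.ham F) : ℂ) - Complex.I * T.omega ξ (T.J (T.ham F))))
      = T.antiholPart F ξ := by
  have h : T.omega ξ (T.J (T.ham F)) = -T.omega (T.J ξ) (T.ham F) := by
    have := T.omega_J_J (T.J ξ) (T.ham F)
    rw [T.J_sq, T.omega_swap (-ξ), map_neg, T.omega_swap _ ξ] at this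
    linarith
  rw [antiholPart, ← T.two_mul_omega_ham F ξ, ← T.two_mul_omega_ham F (T.J ξ), h]
  push_cast
  ring

/-- Quantization of `F` on holomorphic wave functions:
`(F̌ ψ)(ξ) = F⁺(ξ) ψ(ξ) - i (D_{X_{F⁻}} ψ)(ξ)`, where `X_{F⁻} = (X_F - i J X_F) / 2`. -/
def holQuant (F : StrongDual ℝ L) (ψ : L → ℂ) (ξ : L) : ℂ :=
  T.holPart F ξ * ψ ξ
    - Complex.I * (1 / 2 * (lineDeriv ℝ ψ ξ (T.ham F)
        - Complex.I * lineDeriv ℝ ψ ξ (T.J (T.ham F))))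

/-- The functions on `Hat Q` generated by the action of products of continuous linear observables
on the reduced wave functions of coherent states. -/
def schrCPFun : Submodule ℂ (Hat T.Q → ℂ) :=
  Submodule.span ℂ (Set.range fun p : List (StrongDual ℝ L) × L =>
    p.1.foldr T.schrQuant (T.schrCoherent p.2))

/-- The functions on `L` generated by the action of products of continuous linear observables
on the holomorphic wave functions of coherent states. -/
def holCPFun : Submodule ℂ (L → ℂ) :=
  Submodule.span ℂ (Set.range fun p : List (StrongDual ℝ L) × L =>
    p.1.foldr T.holQuant (T.holCoherent p.2))

/-- The states in `L²(Hat Q, ν_Q)` given by the functions in `schrCPFun`. -/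
def HScp : Submodule ℂ T.HS where
  carrier := {u | ∃ ψ ∈ T.schrCPFun, u =ᵐ[T.nuQ] ψ}
  add_mem' := by
    rintro u v ⟨ψ, hψ, hu⟩ ⟨χ, hχ, hv⟩
    exact ⟨ψ + χ, add_mem hψ hχ, (Lp.coeFn_add u v).trans (hu.add hv)⟩
  zero_mem' := ⟨0, zero_mem _, Lp.coeFn_zero _ _ _⟩
  smul_mem' := by
    rintro c u ⟨ψ, hψ, hu⟩
    exact ⟨c • ψ, Submodule.smul_mem _ c hψ, (Lp.coeFn_smul c u).trans (hu.const_smul c)⟩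

/-- The holomorphic states with wave function in `holCPFun`. -/
def HHcp : Submodule ℂ T.HH := T.holCPFun.comap T.wave

end FieldTheory

end
end OecklQuantization

/-! Both Hilbert spaces carry a total family of states indexed by `L` with the same Gram matrix,
`⟨k_τ, k_σ⟩ = exp(-(‖τ‖² + ‖σ‖²)/4 + {σ, τ}/2)`. Such families are matched by exactly one isometric
isomorphism, which is `B` (`existsUnique_linearIsometryEquiv`).

On the Schrödinger side the overlap is a Gaussian integral
(`inner_schrCoherentState_schrCoherentState`). Totality is injectivity of the Fourier transform of
measures on `Hat Q`: for `τ ∈ M` the function `k_τ` is a constant times a pure phase, and every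
functional on `Q` occurs in such a phase (`mem_HS_eq_zero`).

On the holomorphic side everything rests on the reproducing property (`inner_holCoherentLp_eq`). A
Cameron–Martin shift turns the inner product with `K_τ` into the mean of a holomorphic function, and
the mean is its value at the origin because `nuL` is invariant under multiplication by phases.
Totality (`HH_le_closure_span`) follows by projecting a cylindrical holomorphic function to the
closed span of the coherent states of its finite-dimensional quotient: the remainder has vanishing
wave function there, hence vanishes.

For the observables, write `X = X_F` and let `A` be multiplication by the linear exponent of `k_X`.
Then `F̌ = i (A - D_{qX})` generates, up to the factor `i`, the family `ψ ↦ e^{tA} ψ(· - t qX)`. By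
Cameron–Martin, pairing this family with `k_σ` is the same as pairing `ψ` with `k_{σ - tX}`, up to
an explicit scalar. Since `⟨k_σ, ψ⟩` is `e^{-‖σ‖²/4}` times the wave function of `Bψ` at `σ`,
differentiating at `t = 0` turns `F̌` into the holomorphic quantization (`wave_schrQuantCP`).
Differentiation under the integral is justified by working with exponential polynomials, a class
closed under `F̌`. The intertwining formula also shows that `F̌` respects almost everywhere
equality, since the right-hand side sees only the state. -/

namespace OecklQuantization
noncomputable section

/-! ### Gaussian measures on `Hat E`: Fourier uniqueness, exponential integrals and Cameron–Martin.
-/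

section gaussian
variable {E : Type*} [SeminormedAddCommGroup E] [NormedSpace ℝ E]

theorem measurable_exp_eval_mul_I (f : StrongDual ℝ E) :
    Measurable fun x : Hat E => Complex.exp (x f * Complex.I) :=
  Complex.measurable_exp.comp
    ((Complex.measurable_ofReal.comp (measurable_eval f)).mul_const Complex.I)

theorem measurable_ext (l : E →L[ℝ] ℂ) : Measurable fun x : Hat E => ext l x :=
  (Complex.measurable_ofReal.comp (measurable_eval _)).add
    ((Complex.measurable_ofReal.comp (measurable_eval _)).mul_const _)

theorem measurableSpace_hat_eq_comap :
    (instMeasurableSpaceHat : MeasurableSpace (Hat E))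
      = MeasurableSpace.comap (fun (x : Hat E) (f : StrongDual ℝ E) => x f) inferInstance := by
  simp only [instMeasurableSpaceHat, MeasurableSpace.pi, MeasurableSpace.comap_iSup,
    MeasurableSpace.comap_comp]
  rfl

/-- A finite measure on `Hat E` is determined by its characteristic function. -/
theorem measure_hat_ext {μ ν : Measure (Hat E)} [IsFiniteMeasure μ] [IsFiniteMeasure ν]
    (h : ∀ f : StrongDual ℝ E, ∫ x : Hat E, Complex.exp (x f * Complex.I) ∂μ
      = ∫ x : Hat E, Complex.exp (x f * Complex.I) ∂ν) : μ = ν := by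
  let ev : Hat E → StrongDual ℝ E → ℝ := fun x f => x f
  have hev : Measurable ev := measurable_pi_lambda _ fun f => measurable_eval f
  have hmap : μ.map ev = ν.map ev := by
    classical
    -- The finite-dimensional marginals determine the measure, and a linear functional of finitely
    -- many evaluations is the evaluation at one linear combination.
    refine IsProjectiveLimit.unique (P := fun I => (ν.map ev).map I.restrict) (fun I => ?_)
      fun I => rfl
    refine Measure.ext_of_charFunDual (funext fun l => ?_)
    have key : ∀ ρ : Measure (Hat E), charFunDual ((ρ.map ev).map I.restrict) l
        = ∫ x : Hat E, Complex.exp (x (∑ i : I, l (Pi.single i 1) • (i : StrongDual ℝ E))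
          * Complex.I) ∂ρ := fun ρ => by
      rw [Measure.map_map (by fun_prop) hev, charFunDual_apply, integral_map
        (by fun_prop) (by fun_prop)]
      congr with x
      congr 3
      have hx : ∀ y : I → ℝ, l y = ∑ i, l (Pi.single i 1) * y i := fun y => by
        conv_lhs => rw [← Finset.univ_sum_single y]
        rw [map_sum]
        refine Finset.sum_congr rfl fun i _ => ?_
        rw [mul_comm, ← smul_eq_mul, ← map_smul, ← Pi.single_smul, smul_eq_mul, mul_one]
      rw [hx]
      simp [ev]
    rw [key, key, h]
  ext s hs
  rw [measurableSpace_hat_eq_comap] at hs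
  obtain ⟨t, ht, rfl⟩ := hs
  change μ (ev ⁻¹' t) = ν (ev ⁻¹' t)
  rw [← Measure.map_apply hev ht, hmap, Measure.map_apply hev ht]

theorem measure_hat_ext_of_map {μ ν : Measure (Hat E)} [IsFiniteMeasure μ] [IsFiniteMeasure ν]
    (h : ∀ f : StrongDual ℝ E, μ.map (fun x : Hat E => x f) = ν.map fun x : Hat E => x f) :
    μ = ν := by
  refine measure_hat_ext fun f => ?_
  have key : ∀ ρ : Measure (Hat E), ∫ x : Hat E, Complex.exp (x f * Complex.I) ∂ρ
      = ∫ y : ℝ, Complex.exp (y * Complex.I) ∂(ρ.map fun x : Hat E => x f) := fun ρ => by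
    rw [integral_map (measurable_eval f).aemeasurable (by fun_prop)]
  rw [key, key, h]

/-- The positive and negative parts of `u` are densities of finite measures with the same
characteristic function, so these measures and then their densities agree. -/
theorem ae_eq_zero_of_integral_exp_mul_ofReal {μ : Measure (Hat E)} {u : Hat E → ℝ}
    (hu : Integrable u μ)
    (h : ∀ f : StrongDual ℝ E, ∫ x : Hat E, Complex.exp (x f * Complex.I) * (u x : ℂ) ∂μ = 0) :
    u =ᵐ[μ] 0 := by
  have hfin : ∀ w : Hat E → ℝ, Integrable w μ →
      IsFiniteMeasure (μ.withDensity fun x => ENNReal.ofReal (w x)) := fun w hw =>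
    isFiniteMeasure_withDensity_ofReal hw.2
  have hint : ∀ w : Hat E → ℝ, Integrable w μ → ∀ f : StrongDual ℝ E,
      ∫ x : Hat E, Complex.exp (x f * Complex.I) ∂(μ.withDensity fun x => ENNReal.ofReal (w x))
        = ∫ x : Hat E, Complex.exp (x f * Complex.I) * (max (w x) 0 : ℝ) ∂μ := fun w hw f => by
    rw [integral_withDensity_eq_integral_toReal_smul₀ hw.1.aemeasurable.ennreal_ofReal
      (ae_of_all _ fun _ => ENNReal.ofReal_lt_top)]
    refine integral_congr_ae (ae_of_all _ fun x => ?_)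
    simp only [ENNReal.toReal_ofReal']
    rw [Complex.real_smul, mul_comm]
  have := hfin u hu
  have := hfin (fun x => -u x) hu.neg
  have hi : ∀ w : Hat E → ℝ, Integrable w μ → ∀ f : StrongDual ℝ E,
      Integrable (fun x : Hat E => Complex.exp (x f * Complex.I) * (max (w x) 0 : ℝ)) μ :=
    fun w hw f => by
      refine (hw.pos_part.ofReal (𝕜 := ℂ)).bdd_mul (c := 1) ?_ (ae_of_all _ fun x => ?_)
      · exact (measurable_exp_eval_mul_I f).aestronglyMeasurable
      · rw [Complex.norm_exp_ofReal_mul_I]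
  have heq : (μ.withDensity fun x => ENNReal.ofReal (u x))
      = μ.withDensity fun x => ENNReal.ofReal (-u x) := by
    refine measure_hat_ext fun f => ?_
    rw [hint u hu, hint (fun x => -u x) hu.neg, ← sub_eq_zero,
      ← integral_sub (hi u hu f) (hi (fun x => -u x) hu.neg f), ← h f]
    congr with x
    rw [← mul_sub, ← Complex.ofReal_sub]
    congr 2
    rcases le_total (u x) 0 with h | h <;> simp [h]
  have h2 := (withDensity_eq_iff hu.1.aemeasurable.ennreal_ofReal
    hu.neg.1.aemeasurable.ennreal_ofReal hu.lintegral_lt_top.ne).1 heq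
  filter_upwards [h2] with x hx
  have hx' := congrArg ENNReal.toReal hx
  simp only [ENNReal.toReal_ofReal', Pi.neg_apply] at hx'
  rcases le_total (u x) 0 with h | h <;> simp [h] at hx' ⊢ <;> linarith

/-- An integrable function on `Hat E` is determined by its Fourier transform. -/
theorem ae_eq_zero_of_integral_exp_mul {μ : Measure (Hat E)} {u : Hat E → ℂ}
    (hu : Integrable u μ)
    (h : ∀ f : StrongDual ℝ E, ∫ x : Hat E, Complex.exp (x f * Complex.I) * u x ∂μ = 0) :
    u =ᵐ[μ] 0 := by
  have hi : ∀ w : Hat E → ℂ, Integrable w μ → ∀ f : StrongDual ℝ E,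
      Integrable (fun x : Hat E => Complex.exp (x f * Complex.I) * w x) μ := fun w hw f => by
    refine hw.bdd_mul (c := 1) ?_ (ae_of_all _ fun x => ?_)
    · exact (measurable_exp_eval_mul_I f).aestronglyMeasurable
    · rw [Complex.norm_exp_ofReal_mul_I]
  -- Conjugating the hypothesis at `-f` gives the same vanishing for the conjugate of `u`, which
  -- reduces the claim to the real and imaginary parts.
  have hconj : ∀ f : StrongDual ℝ E,
      ∫ x : Hat E, Complex.exp (x f * Complex.I) * (starRingEnd ℂ) (u x) ∂μ = 0 := fun f => by
    have := congrArg (starRingEnd ℂ) (h (-f))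
    rw [← integral_conj, map_zero] at this
    rw [← this]
    congr with x
    simp [← Complex.exp_conj]
  have hc : Integrable (fun x => (starRingEnd ℂ) (u x)) μ :=
    (LinearIsometryEquiv.integrable_comp_iff Complex.conjLIE).2 hu
  have hre := ae_eq_zero_of_integral_exp_mul_ofReal hu.re fun f => by
    have h1 := integral_add (hi _ hu f) (hi _ hc f)
    rw [h f, hconj f, add_zero] at h1
    have h2 : (fun x : Hat E => Complex.exp (x f * Complex.I) * (RCLike.re (u x) : ℂ))
      = fun x => (1 / 2 : ℂ) * (Complex.exp (x f * Complex.I) * u x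
          + Complex.exp (x f * Complex.I) * (starRingEnd ℂ) (u x)) := by
      funext x
      rw [← mul_add, Complex.add_conj]
      simp; ring
    rw [h2, integral_const_mul, h1, mul_zero]
  have him := ae_eq_zero_of_integral_exp_mul_ofReal hu.im fun f => by
    have h1 := integral_sub (hi _ hu f) (hi _ hc f)
    rw [h f, hconj f, sub_zero] at h1
    have h2 : (fun x : Hat E => Complex.exp (x f * Complex.I) * (RCLike.im (u x) : ℂ))
      = fun x => (-Complex.I / 2 : ℂ) * (Complex.exp (x f * Complex.I) * u x
          - Complex.exp (x f * Complex.I) * (starRingEnd ℂ) (u x)) := by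
      funext x
      rw [← mul_sub, Complex.sub_conj]
      simp
      linear_combination (Complex.exp (x f * Complex.I) * (u x).im) * Complex.I_sq
    rw [h2, integral_const_mul, h1, mul_zero]
  filter_upwards [hre, him] with x h1 h2
  exact Complex.ext h1 h2

namespace IsHatGaussian

variable {ν : Measure (Hat E)} {v : ℝ≥0} {H : Type*} [NormedAddCommGroup H]
  [InnerProductSpace ℝ H]

theorem isProbabilityMeasure (hν : IsHatGaussian ν v) : IsProbabilityMeasure ν := by
  constructor
  have h := Measure.map_apply (μ := ν) (measurable_eval (0 : StrongDual ℝ E)) MeasurableSet.univ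
  rw [hν, measure_univ] at h
  exact h.symm

theorem integrable_exp (hν : IsHatGaussian ν v) (f : StrongDual ℝ E) :
    Integrable (fun x : Hat E => Real.exp (x f)) ν := by
  have h : Integrable (fun y : ℝ => Real.exp (1 * y)) (ν.map fun x : Hat E => x f) := by
    rw [hν]
    exact integrable_exp_mul_gaussianReal 1
  simpa [Function.comp_def] using h.comp_measurable (measurable_eval f)

theorem integral_exp (hν : IsHatGaussian ν v) (f : StrongDual ℝ E) :
    ∫ x : Hat E, Real.exp (x f) ∂ν = Real.exp (v / 2 * ‖f‖ ^ 2) := by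
  have := mgf_gaussianReal (hν f) 1
  simp only [mgf, one_mul] at this
  rw [this]
  congr 1
  push_cast
  ring

/-- Tilting a Gaussian keeps variances and moves each mean by the covariance. The moment generating
functions agree by completing the square; being finite everywhere, they continue analytically and
determine the law. The isometry `A` supplies the inner product on the dual. -/
theorem map_tilted (hν : IsHatGaussian ν v) (A : StrongDual ℝ E →ₗᵢ[ℝ] H)
    (a b : StrongDual ℝ E) :
    (ν.tilted fun x : Hat E => x a).map (fun x : Hat E => x b)
      = gaussianReal (v * ⟪A a, A b⟫_ℝ) (v * ‖b‖₊ ^ 2) := by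
  have := hν.isProbabilityMeasure
  have := isProbabilityMeasure_tilted (hν.integrable_exp a)
  have hset : integrableExpSet (fun x : Hat E => x b) (ν.tilted fun x : Hat E => x a)
      = Set.univ := by
    refine Set.eq_univ_of_forall fun t => ?_
    rw [integrableExpSet, Set.mem_ofPred_eq, integrable_tilted_iff (hν.integrable_exp a)]
    refine (hν.integrable_exp (a + t • b)).congr (ae_of_all _ fun x => ?_)
    simp [Real.exp_add]
  have hm : mgf (fun x : Hat E => x b) (ν.tilted fun x : Hat E => x a)
      = mgf id (gaussianReal (v * ⟪A a, A b⟫_ℝ) (v * ‖b‖₊ ^ 2)) := by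
    funext t
    rw [mgf_id_gaussianReal, mgf, integral_exp_tilted, hν.integral_exp]
    have h1 : (fun x : Hat E => Real.exp (((fun x : Hat E => x a) + fun x : Hat E => t * x b) x))
        = fun x => Real.exp (x (a + t • b)) := by
      funext x; simp
    rw [h1, hν.integral_exp, ← Real.exp_sub]
    congr 1
    have h2 := norm_add_sq_real (A a) (A (t • b))
    rw [← map_add, A.norm_map, A.norm_map, A.norm_map, norm_smul, map_smul, inner_smul_right,
      mul_pow, Real.norm_eq_abs, sq_abs] at h2
    rw [h2]
    push_cast
    ring
  have hc : complexMGF (fun x : Hat E => x b) (ν.tilted fun x : Hat E => x a)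
      = complexMGF id (gaussianReal (v * ⟪A a, A b⟫_ℝ) (v * ‖b‖₊ ^ 2)) := by
    funext z
    refine eqOn_complexMGF_of_mgf hm ?_
    simp [hset]
  have h2 := Measure.ext_of_complexMGF_eq (measurable_eval b).aemeasurable aemeasurable_id hc
  rwa [Measure.map_id] at h2

/-- The Gaussian integral of the exponential of a complex linear functional. -/
theorem integral_exp_add_mul_I (hν : IsHatGaussian ν v) (A : StrongDual ℝ E →ₗᵢ[ℝ] H)
    (a b : StrongDual ℝ E) :
    ∫ x : Hat E, Complex.exp ((x a : ℂ) + x b * Complex.I) ∂ν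
      = Complex.exp (v / 2 * ((‖A a‖ ^ 2 - ‖A b‖ ^ 2 : ℝ) + 2 * ⟪A a, A b⟫_ℝ * Complex.I)) := by
  -- The real part of the exponent is absorbed by tilting, and the imaginary part becomes a
  -- characteristic function at `1`.
  have h1 : charFun ((ν.tilted fun x : Hat E => x a).map (fun x : Hat E => x b)) 1
      = ∫ x : Hat E, Complex.exp (x b * Complex.I) ∂(ν.tilted fun x : Hat E => x a) := by
    rw [charFun_apply_real, integral_map (measurable_eval b).aemeasurable (by fun_prop)]
    simp
  rw [hν.map_tilted A, charFun_gaussianReal, integral_tilted, hν.integral_exp] at h1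
  have h2 : ∀ x : Hat E, Complex.exp ((x a : ℂ) + x b * Complex.I)
      = (Real.exp (v / 2 * ‖a‖ ^ 2) : ℂ) *
        ((Real.exp (x a) / Real.exp (v / 2 * ‖a‖ ^ 2)) • Complex.exp (x b * Complex.I)) := by
    intro x
    rw [Complex.exp_add, Complex.real_smul]
    push_cast
    field_simp
  simp_rw [h2]
  rw [integral_const_mul, ← h1, Complex.ofReal_exp, ← Complex.exp_add, A.norm_map, A.norm_map]
  congr 1
  push_cast
  ring

/-- The Cameron–Martin formula. -/
theorem tilted_eq_map_add (hν : IsHatGaussian ν v) (A : StrongDual ℝ E →ₗᵢ[ℝ] H)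
    (a : StrongDual ℝ E) (y : Hat E) (hy : ∀ b, y b = v * ⟪A a, A b⟫_ℝ) :
    (ν.tilted fun x : Hat E => x a) = ν.map fun x => x + y := by
  have := hν.isProbabilityMeasure
  have := isProbabilityMeasure_tilted (hν.integrable_exp a)
  have hm : Measurable fun x : Hat E => x + y := measurable_toHat fun f => by
    simpa using (measurable_eval f).add_const (y f)
  refine measure_hat_ext_of_map fun b => ?_
  rw [hν.map_tilted A, Measure.map_map (measurable_eval b) hm]
  have h1 : ((fun x : Hat E => x b) ∘ fun x => x + y)
      = (fun t : ℝ => t + y b) ∘ fun x : Hat E => x b := by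
    funext x; simp
  rw [h1, ← Measure.map_map (measurable_add_const _) (measurable_eval b), hν,
    gaussianReal_map_add_const, zero_add, hy]

/-- Cameron–Martin as a change of variables: `hy` says that `y` is `v` times the vector dual to `a`,
and `v / 2 * ‖a‖ ^ 2` normalizes the tilt. -/
theorem integral_add (hν : IsHatGaussian ν v) (A : StrongDual ℝ E →ₗᵢ[ℝ] H)
    (a : StrongDual ℝ E) (y : Hat E) (hy : ∀ b, y b = v * ⟪A a, A b⟫_ℝ) {G : Hat E → ℂ}
    (hG : Measurable G) :
    ∫ x, G (x + y) ∂ν = ∫ x : Hat E, Complex.exp (x a - v / 2 * ‖a‖ ^ 2) * G x ∂ν := by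
  have hm : Measurable fun x : Hat E => x + y := measurable_toHat fun f => by
    simpa using (measurable_eval f).add_const (y f)
  rw [← integral_map (f := G) hm.aemeasurable hG.aestronglyMeasurable, ← hν.tilted_eq_map_add A a y hy,
    integral_tilted, hν.integral_exp]
  congr with x
  rw [Complex.real_smul, Complex.exp_sub]
  push_cast
  rfl

theorem integrable_add (hν : IsHatGaussian ν v) (A : StrongDual ℝ E →ₗᵢ[ℝ] H)
    (a : StrongDual ℝ E) (y : Hat E) (hy : ∀ b, y b = v * ⟪A a, A b⟫_ℝ) {G : Hat E → ℂ}
    (hG : Measurable G) (hi : Integrable (fun x : Hat E => Complex.exp (x a) * G x) ν) :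
    Integrable (fun x => G (x + y)) ν := by
  have hm : Measurable fun x : Hat E => x + y := measurable_toHat fun f => by
    simpa using (measurable_eval f).add_const (y f)
  have := (integrable_map_measure (f := fun x => x + y) (μ := ν) hG.aestronglyMeasurable
    hm.aemeasurable).1
  refine this ?_
  rw [← hν.tilted_eq_map_add A a y hy, integrable_tilted_iff (hν.integrable_exp a)]
  refine hi.congr (ae_of_all _ fun x => ?_)
  simp

end IsHatGaussian
end gaussian
-- The complex structure of `L` and `Hat L`, and the mean value property of `nuL`.
namespace FieldTheory

variable {L : Type*} [NormedAddCommGroup L] [InnerProductSpace ℝ L] (T : FieldTheory L)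

section complexStructure

theorem inner_J_J (τ ξ : L) : ⟪T.J τ, T.J ξ⟫_ℝ = ⟪τ, ξ⟫_ℝ := by
  rw [inner_eq_omega, omega_J_J, inner_eq_omega]

theorem inner_J_left (τ ξ : L) : ⟪T.J τ, ξ⟫_ℝ = 2 * T.omega τ ξ := by
  rw [inner_eq_omega, omega_J_J]

theorem inner_J_right (τ ξ : L) : ⟪τ, T.J ξ⟫_ℝ = -(2 * T.omega τ ξ) := by
  rw [inner_eq_omega, J_sq, map_neg, mul_neg]

theorem omega_self (τ : L) : T.omega τ τ = 0 := by
  have := T.omega_swap τ τ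
  linarith

/-- The complex structure as a linear isometry. -/
def JIsom : L →ₗᵢ[ℝ] L := T.J.isometryOfInner T.inner_J_J

theorem JIsom_apply (ξ : L) : T.JIsom ξ = T.J ξ := rfl

theorem norm_J (ξ : L) : ‖T.J ξ‖ = ‖ξ‖ := T.JIsom.norm_map ξ

theorem herm_eq_inner (τ ξ : L) :
    T.herm τ ξ = (⟪τ, ξ⟫_ℝ : ℂ) + ⟪T.J τ, ξ⟫_ℝ * Complex.I := by
  rw [herm_apply, inner_J_left]
  push_cast
  ring

theorem ext_herm (τ : L) (x : Hat L) :
    ext (T.herm τ) x = (x (innerSL ℝ τ) : ℂ) + x (innerSL ℝ (T.J τ)) * Complex.I := by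
  have h1 : Complex.reCLM.comp (T.herm τ) = innerSL ℝ τ := by
    ext ξ; simp [herm_eq_inner]
  have h2 : Complex.imCLM.comp (T.herm τ) = innerSL ℝ (T.J τ) := by
    ext ξ; simp [herm_eq_inner]
  rw [ext, h1, h2]

theorem herm_self (τ : L) : T.herm τ τ = (‖τ‖ ^ 2 : ℝ) := by
  rw [herm_apply, omega_self, real_inner_self_eq_norm_sq]
  simp

theorem herm_conj_symm (τ ξ : L) : (starRingEnd ℂ) (T.herm ξ τ) = T.herm τ ξ := by
  rw [herm_apply, herm_apply, T.omega_swap ξ τ, real_inner_comm]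
  simp [Complex.conj_ofNat]

theorem herm_add_left (τ τ' : L) : T.herm (τ + τ') = T.herm τ + T.herm τ' := by
  ext ξ
  simp only [add_apply]
  rw [← herm_conj_symm, map_add, map_add, herm_conj_symm, herm_conj_symm]

/-- Multiplication by complex numbers on `(L, J)`. -/
def cmul (z : ℂ) : L →ₗ[ℝ] L := z.re • LinearMap.id + z.im • T.J

theorem cmul_apply (z : ℂ) (ξ : L) : T.cmul z ξ = z.re • ξ + z.im • T.J ξ := rfl

theorem map_cmul {l : L →L[ℝ] ℂ} (hl : ∀ ξ, l (T.J ξ) = Complex.I * l ξ) (z : ℂ) (ξ : L) :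
    l (T.cmul z ξ) = z * l ξ := by
  rw [cmul_apply, map_add, map_smul, map_smul, hl, Complex.real_smul, Complex.real_smul]
  nth_rw 3 [← Complex.re_add_im z]
  ring

theorem herm_cmul_right (τ : L) (z : ℂ) (ξ : L) : T.herm τ (T.cmul z ξ) = z * T.herm τ ξ :=
  T.map_cmul (T.herm_J τ) z ξ

theorem herm_cmul_left (z : ℂ) (τ : L) :
    T.herm (T.cmul z τ) = (starRingEnd ℂ) z • T.herm τ := by
  ext ξ
  rw [← herm_conj_symm, herm_cmul_right, map_mul, herm_conj_symm]
  rfl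

theorem norm_cmul (z : ℂ) (ξ : L) : ‖T.cmul z ξ‖ = ‖z‖ * ‖ξ‖ := by
  have h := T.herm_self (T.cmul z ξ)
  rw [herm_cmul_left, FunLike.coe_smul, Pi.smul_apply, herm_cmul_right, herm_self, smul_eq_mul,
    ← mul_assoc, mul_comm _ z, Complex.mul_conj, Complex.normSq_eq_norm_sq, ← Complex.ofReal_mul,
    Complex.ofReal_inj, ← mul_pow] at h
  exact (pow_left_inj₀ (by positivity) (by positivity) two_ne_zero).1 h.symm

/-- The complex structure of `Hat L`. -/
def hatJ : Hat L →ₗ[ℝ] Hat L where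
  toFun x :=
    { toFun f := x (f.comp T.JIsom.toContinuousLinearMap)
      map_add' f g := by rw [ContinuousLinearMap.add_comp, map_add]
      map_smul' c f := by rw [ContinuousLinearMap.smul_comp, map_smul]; rfl }
  map_add' _ _ := rfl
  map_smul' _ _ := rfl

theorem hatJ_apply (x : Hat L) (f : StrongDual ℝ L) :
    T.hatJ x f = x (f.comp T.JIsom.toContinuousLinearMap) := rfl

/-- Multiplication by complex numbers on `Hat L`. -/
def hatCmul (z : ℂ) : Hat L →ₗ[ℝ] Hat L := z.re • LinearMap.id + z.im • T.hatJ

theorem hatCmul_apply (z : ℂ) (x : Hat L) : T.hatCmul z x = z.re • x + z.im • T.hatJ x := rfl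

theorem hatCmul_apply_apply (z : ℂ) (x : Hat L) (f : StrongDual ℝ L) :
    T.hatCmul z x f = z.re * x f + z.im * x (f.comp T.JIsom.toContinuousLinearMap) := rfl

theorem hatCmul_apply_eq (z : ℂ) (x : Hat L) (f : StrongDual ℝ L) :
    T.hatCmul z x f = x (z.re • f + z.im • f.comp T.JIsom.toContinuousLinearMap) := by
  simp [hatCmul_apply_apply]

end complexStructure

end FieldTheory

section ext
variable {E : Type*} [SeminormedAddCommGroup E] [NormedSpace ℝ E]

theorem ext_add (l l' : E →L[ℝ] ℂ) (x : Hat E) : ext (l + l') x = ext l x + ext l' x := by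
  simp only [ext, ContinuousLinearMap.comp_add, map_add]
  push_cast
  ring

theorem ext_smul (c : ℂ) (l : E →L[ℝ] ℂ) (x : Hat E) : ext (c • l) x = c * ext l x := by
  have h1 : Complex.reCLM.comp (c • l) = c.re • Complex.reCLM.comp l - c.im • Complex.imCLM.comp l := by
    ext; simp
  have h2 : Complex.imCLM.comp (c • l) = c.re • Complex.imCLM.comp l + c.im • Complex.reCLM.comp l := by
    ext; simp
  simp only [ext, h1, h2, map_add, map_sub, map_smul, smul_eq_mul]
  push_cast
  nth_rw 5 [← Complex.re_add_im c]
  linear_combination (-(c.im : ℂ) * x (Complex.imCLM.comp l)) * Complex.I_sq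

theorem ext_sum {ι : Type*} (s : Finset ι) (l : ι → E →L[ℝ] ℂ) (x : Hat E) :
    ext (∑ i ∈ s, l i) x = ∑ i ∈ s, ext (l i) x := by
  classical
  induction s using Finset.induction_on with
  | empty => simp [ext]
  | insert i s hi ih => rw [Finset.sum_insert hi, Finset.sum_insert hi, ext_add, ih]

theorem ext_add_right (l : E →L[ℝ] ℂ) (x y : Hat E) : ext l (x + y) = ext l x + ext l y := by
  simp only [ext, LinearMap.add_apply]
  push_cast
  ring

theorem ext_smul_right (l : E →L[ℝ] ℂ) (c : ℝ) (x : Hat E) : ext l (c • x) = c * ext l x := by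
  simp only [ext, LinearMap.smul_apply, smul_eq_mul]
  push_cast
  ring

theorem ext_ofReal_comp (f : StrongDual ℝ E) (x : Hat E) :
    ext (Complex.ofRealCLM.comp f) x = x f := by
  have h1 : Complex.reCLM.comp (Complex.ofRealCLM.comp f) = f := by ext; simp
  have h2 : Complex.imCLM.comp (Complex.ofRealCLM.comp f) = 0 := by ext; simp
  simp [ext, h1, h2]

end ext

namespace FieldTheory
variable {L : Type*} [NormedAddCommGroup L] [InnerProductSpace ℝ L] (T : FieldTheory L)

theorem ext_hatJ {l : L →L[ℝ] ℂ} (hl : ∀ ξ, l (T.J ξ) = Complex.I * l ξ) (x : Hat L) :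
    ext l (T.hatJ x) = Complex.I * ext l x := by
  have h1 : (Complex.reCLM.comp l).comp T.JIsom.toContinuousLinearMap
      = -Complex.imCLM.comp l := by
    ext ξ; simp [JIsom_apply, hl]
  have h2 : (Complex.imCLM.comp l).comp T.JIsom.toContinuousLinearMap
      = Complex.reCLM.comp l := by
    ext ξ; simp [JIsom_apply, hl]
  simp only [ext, hatJ_apply, h1, h2, map_neg]
  push_cast
  linear_combination -(x (Complex.imCLM.comp l) : ℂ) * Complex.I_sq

theorem ext_hatCmul {l : L →L[ℝ] ℂ} (hl : ∀ ξ, l (T.J ξ) = Complex.I * l ξ) (z : ℂ)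
    (x : Hat L) : ext l (T.hatCmul z x) = z * ext l x := by
  rw [hatCmul_apply, ext_add_right, ext_smul_right, ext_smul_right, T.ext_hatJ hl]
  nth_rw 3 [← Complex.re_add_im z]
  ring

theorem measurable_hatCmul : Measurable fun p : ℂ × Hat L => T.hatCmul p.1 p.2 :=
  measurable_toHat fun f => by
    simp only [hatCmul_apply_apply]
    exact ((Complex.measurable_re.comp measurable_fst).mul
      ((measurable_eval _).comp measurable_snd)).add
      ((Complex.measurable_im.comp measurable_fst).mul ((measurable_eval _).comp measurable_snd))

variable [CompleteSpace L]

/-- By Riesz, rotating a functional by `z` multiplies its representing vector by the conjugate of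
`z`. -/
theorem norm_rotate {z : ℂ} (hz : ‖z‖ = 1) (f : StrongDual ℝ L) :
    ‖z.re • f + z.im • f.comp T.JIsom.toContinuousLinearMap‖ = ‖f‖ := by
  obtain ⟨a, rfl⟩ := (InnerProductSpace.toDual ℝ L).surjective f
  have h : z.re • InnerProductSpace.toDual ℝ L a
      + z.im • (InnerProductSpace.toDual ℝ L a).comp T.JIsom.toContinuousLinearMap
      = InnerProductSpace.toDual ℝ L (T.cmul ((starRingEnd ℂ) z) a) := by
    ext ξ
    simp [JIsom_apply, cmul_apply, T.inner_J_left,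
      T.inner_J_right]
  rw [h, LinearIsometryEquiv.norm_map, LinearIsometryEquiv.norm_map, norm_cmul]
  simp [hz]

theorem measurePreserving_hatCmul {z : ℂ} (hz : ‖z‖ = 1) :
    MeasurePreserving (T.hatCmul z) T.nuL T.nuL := by
  have hm : Measurable (T.hatCmul z) := T.measurable_hatCmul.comp (measurable_const.prodMk
    measurable_id)
  have := T.isHatGaussian_nuL.isProbabilityMeasure
  refine ⟨hm, measure_hat_ext_of_map fun f => ?_⟩
  rw [Measure.map_map (measurable_eval f) hm]
  have h : (fun x : Hat L => x f) ∘ T.hatCmul z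
      = fun x : Hat L => x (z.re • f + z.im • f.comp T.JIsom.toContinuousLinearMap) := by
    funext x
    exact T.hatCmul_apply_eq z x f
  have hn : ‖z.re • f + z.im • f.comp T.JIsom.toContinuousLinearMap‖₊ = ‖f‖₊ :=
    NNReal.eq (T.norm_rotate hz f)
  rw [h, T.isHatGaussian_nuL, T.isHatGaussian_nuL, hn]

set_option maxHeartbeats 1000000 in
/-- The mean value property of holomorphic functions with respect to `ν_L`. -/
theorem integral_eq_of_differentiable {ψ : Hat L → ℂ} (hm : Measurable ψ)
    (hi : Integrable ψ T.nuL) (hd : ∀ x, Differentiable ℂ fun z : ℂ => ψ (T.hatCmul z x)) :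
    ∫ x, ψ x ∂T.nuL = ψ 0 := by
  have := T.isHatGaussian_nuL.isProbabilityMeasure
  let c : ℝ → ℂ := circleMap 0 1
  have hc : ∀ θ, ‖c θ‖ = 1 := fun θ => by simp [c]
  have hcm : Measurable c := (continuous_circleMap 0 1).measurable
  have hrot : ∀ θ, ∫ x, ψ (T.hatCmul (c θ) x) ∂T.nuL = ∫ x, ψ x ∂T.nuL := fun θ => by
    rw [← integral_map (f := ψ) (T.measurePreserving_hatCmul (hc θ)).measurable.aemeasurable
      hm.aestronglyMeasurable, (T.measurePreserving_hatCmul (hc θ)).map_eq]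
  have hrotn : ∀ θ, ∫ x, ‖ψ (T.hatCmul (c θ) x)‖ ∂T.nuL = ∫ x, ‖ψ x‖ ∂T.nuL := fun θ => by
    rw [← integral_map (f := fun x => ‖ψ x‖)
      (T.measurePreserving_hatCmul (hc θ)).measurable.aemeasurable
      hm.norm.aestronglyMeasurable, (T.measurePreserving_hatCmul (hc θ)).map_eq]
  -- Each complex line through the origin contributes `ψ 0` as its circle average, whereas for fixed
  -- angle the integral over `Hat L` does not depend on the angle. Fubini compares the two.
  have hmean : ∀ x, ∫ θ in Set.Ioc 0 (2 * Real.pi), ψ (T.hatCmul (c θ) x)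
      = (2 * Real.pi) * ψ 0 := fun x => by
    have h1 := (hd x).diffContOnCl (s := Metric.ball 0 |1|) |>.circleAverage
    rw [Real.circleAverage, intervalIntegral.integral_of_le (by positivity)] at h1
    have h2 : T.hatCmul 0 x = 0 := by simp [hatCmul_apply]
    rw [h2] at h1
    rw [← h1, Complex.real_smul]
    push_cast
    field_simp
    rfl
  have hprod : Integrable (Function.uncurry fun (θ : ℝ) (x : Hat L) => ψ (T.hatCmul (c θ) x))
      ((volume.restrict (Set.Ioc 0 (2 * Real.pi))).prod T.nuL) := by
    have hmm : Measurable (Function.uncurry fun (θ : ℝ) (x : Hat L) => ψ (T.hatCmul (c θ) x)) := by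
      have h1 : Measurable fun p : ℝ × Hat L => ((c p.1, p.2) : ℂ × Hat L) :=
        (hcm.comp measurable_fst).prodMk measurable_snd
      have h2 : Measurable fun p : ℝ × Hat L => T.hatCmul (c p.1) p.2 :=
        T.measurable_hatCmul.comp h1
      exact hm.comp h2
    rw [integrable_prod_iff hmm.aestronglyMeasurable]
    refine ⟨ae_of_all _ fun θ => ?_, ?_⟩
    · exact (T.measurePreserving_hatCmul (hc θ)).integrable_comp_of_integrable hi
    · simp only [Function.uncurry_apply_pair, hrotn]
      exact integrable_const _
  have hswap := integral_integral_swap hprod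
  simp only [hrot, hmean] at hswap
  rw [setIntegral_const, integral_const, probReal_univ, one_smul, Real.volume_real_Ioc, sub_zero,
    max_eq_left (by positivity), Complex.real_smul] at hswap
  push_cast at hswap
  have hne : (2 * Real.pi : ℂ) ≠ 0 := by simp [Real.pi_ne_zero]
  exact mul_left_cancel₀ hne hswap

end FieldTheory
-- The reproducing property and holomorphy of wave functions.
namespace FieldTheory

variable {L : Type*} [NormedAddCommGroup L] [InnerProductSpace ℝ L] (T : FieldTheory L)

theorem cmul_cmul (z w : ℂ) (ξ : L) : T.cmul (z * w) ξ = T.cmul z (T.cmul w ξ) := by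
  simp only [cmul_apply, map_add, map_smul, T.J_sq, Complex.mul_re, Complex.mul_im]
  module

/-- `L` as a complex vector space. -/
abbrev complexModule : Module ℂ L where
  smul z ξ := T.cmul z ξ
  one_smul ξ := by change T.cmul 1 ξ = ξ; simp [cmul_apply]
  mul_smul z w ξ := T.cmul_cmul z w ξ
  smul_zero z := map_zero (T.cmul z)
  smul_add z := map_add (T.cmul z)
  add_smul z w ξ := by
    change T.cmul (z + w) ξ = T.cmul z ξ + T.cmul w ξ
    simp only [cmul_apply, Complex.add_re, Complex.add_im]
    module
  zero_smul ξ := by change T.cmul 0 ξ = 0; simp [cmul_apply]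

/-- `L` as a complex normed space. -/
abbrev complexNormedSpace : NormedSpace ℂ L where
  __ := T.complexModule
  norm_smul_le z ξ := (T.norm_cmul z ξ).le

/-- `L` as a complex inner product space. -/
abbrev complexInnerProductSpace : InnerProductSpace ℂ L where
  __ := T.complexNormedSpace
  inner τ ξ := T.herm τ ξ
  norm_sq_eq_re_inner ξ := by rw [herm_self]; exact (Complex.ofReal_re _).symm
  conj_inner_symm τ ξ := T.herm_conj_symm τ ξ
  add_left τ τ' ξ := by rw [herm_add_left]; rfl
  smul_left τ ξ z := by
    change T.herm (T.cmul z τ) ξ = _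
    rw [herm_cmul_left]
    rfl

/-- Complex Riesz turns the functionals into vectors; an orthonormal basis of their complex span
gives the expansion. This reduces cylinder functions to finitely many orthonormal coordinates. -/
theorem exists_orthonormal_expansion [CompleteSpace L] {n : ℕ} (l : Fin n → L →L[ℝ] ℂ)
    (hl : ∀ i ξ, l i (T.J ξ) = Complex.I * l i ξ) :
    ∃ (m : ℕ) (e : Fin m → L), (∀ j k, T.herm (e j) (e k) = if j = k then 1 else 0) ∧
      ∀ i, l i = ∑ k, l i (e k) • T.herm (e k) := by
  let := T.complexInnerProductSpace
  let lc : Fin n → StrongDual ℂ L := fun i =>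
    { toFun := l i
      map_add' := map_add (l i)
      map_smul' := fun z ξ => T.map_cmul (hl i) z ξ
      cont := (l i).continuous }
  let t : Fin n → L := fun i => (InnerProductSpace.toDual ℂ L).symm (lc i)
  have ht : ∀ i ξ, T.herm (t i) ξ = l i ξ := fun i ξ =>
    InnerProductSpace.toDual_symm_apply (𝕜 := ℂ) (x := ξ) (y := lc i)
  let V : Submodule ℂ L := Submodule.span ℂ (Set.range t)
  have : FiniteDimensional ℂ V := FiniteDimensional.span_of_finite ℂ (Set.finite_range t)
  let b := stdOrthonormalBasis ℂ V
  refine ⟨Module.finrank ℂ V, fun k => b k, fun j k => ?_, fun i => ?_⟩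
  · exact orthonormal_iff_ite.1 b.orthonormal j k
  · ext ξ
    have h1 := b.sum_repr' ⟨t i, Submodule.subset_span ⟨i, rfl⟩⟩
    have h2 : t i = ∑ k, T.cmul (T.herm (b k : L) (t i)) (b k : L) := by
      have := congrArg Subtype.val h1
      rw [AddSubmonoidClass.coe_finsetSum] at this
      exact this.symm
    have h3 : T.herm (t i) ξ = ∑ k, T.herm (t i) (b k : L) * T.herm (b k : L) ξ := by
      rw [← T.herm_conj_symm]
      nth_rw 1 [h2]
      rw [map_sum, map_sum]
      refine Finset.sum_congr rfl fun k _ => ?_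
      rw [herm_cmul_right, map_mul, herm_conj_symm, herm_conj_symm]
    rw [ht] at h3
    rw [h3]
    simp [ht]

variable [CompleteSpace L]

theorem holCoherentLp_ae_eq (τ : L) :
    T.holCoherentLp τ =ᵐ[T.nuL] fun x => Complex.exp (1 / 2 * ext (T.herm τ) x) := by
  refine (MemLp.coeFn_toLp _).trans (ae_of_all _ fun x => ?_)
  simp only [ext_smul, add_zero]

theorem inner_holCoherentLp (τ : L) (u : Lp ℂ 2 T.nuL) :
    ⟪T.holCoherentLp τ, u⟫_ℂ
      = ∫ x, (starRingEnd ℂ) (Complex.exp (1 / 2 * ext (T.herm τ) x)) * u x ∂T.nuL := by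
  rw [L2.inner_def]
  refine integral_congr_ae ?_
  filter_upwards [T.holCoherentLp_ae_eq τ] with x hx
  rw [hx, RCLike.inner_apply, mul_comm]

/-- The reproducing property of the coherent states. -/
theorem inner_holCoherentLp_eq (τ : L) {u : Lp ℂ 2 T.nuL} {ψ : Hat L → ℂ} (hu : u =ᵐ[T.nuL] ψ)
    (hm : Measurable ψ) (hd : ∀ x, Differentiable ℂ fun z : ℂ => ψ (T.hatCmul z x + incl τ)) :
    ⟪T.holCoherentLp τ, u⟫_ℂ = ψ (incl τ) := by
  have hL2 : MemLp ψ 2 T.nuL := (memLp_congr_ae hu).1 (Lp.memLp u)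
  -- Since `{τ, x}` plus its conjugate is `2 g(τ, x)`, the conjugate of `K_τ` is `e^{g(τ, x)}` times
  -- the holomorphic factor of `G`. The first factor is the tilt that shifts by `τ`.
  let G : Hat L → ℂ := fun x => Complex.exp (-(1 / 2 * ext (T.herm τ) x)) * ψ x
  have hG : Measurable G := (Complex.measurable_exp.comp
    ((measurable_ext (T.herm τ)).const_mul _).neg).mul hm
  let A := (InnerProductSpace.toDual ℝ L).symm.toLinearIsometry
  have hy : ∀ b, (incl τ : Hat L) b = (1 : ℝ≥0) * ⟪A (innerSL ℝ τ), A b⟫_ℝ := fun b => by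
    have h1 : A (innerSL ℝ τ) = τ := (InnerProductSpace.toDual ℝ L).symm_apply_apply τ
    rw [h1, real_inner_comm, incl_apply]
    simp [A]
  have hexp : ∀ x : Hat L, Complex.exp (x (innerSL ℝ τ)) * G x
      = (starRingEnd ℂ) (Complex.exp (1 / 2 * ext (T.herm τ) x)) * ψ x := fun x => by
    simp only [G]
    rw [← mul_assoc, ← Complex.exp_add, ← Complex.exp_conj]
    congr 2
    rw [ext_herm]
    simp [Complex.conj_ofNat]
    ring
  have hi : Integrable (fun x : Hat L => Complex.exp (x (innerSL ℝ τ)) * G x) T.nuL := by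
    simp only [hexp]
    refine MemLp.integrable_mul (p := 2) (q := 2) ?_ hL2
    refine ((memLp_congr_ae (T.holCoherentLp_ae_eq τ)).1 (Lp.memLp _)).star
  have h1 := T.isHatGaussian_nuL.integrable_add A (innerSL ℝ τ) (incl τ) hy hG hi
  have h2 := T.isHatGaussian_nuL.integral_add A (innerSL ℝ τ) (incl τ) hy hG
  have hm' : Measurable fun x : Hat L => G (x + incl τ) := hG.comp <| measurable_toHat fun f => by
    simpa using (measurable_eval f).add_const (incl τ f)
  -- The mean of the shifted `G` is its value at `τ`, where the factor `e^{-‖τ‖²/2}` cancels against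
  -- the normalization of the tilt.
  rw [T.integral_eq_of_differentiable hm' h1, zero_add] at h2
  · have h3 : ∀ x : Hat L, Complex.exp (x (innerSL ℝ τ) - (1 : ℝ≥0) / 2 * ‖innerSL ℝ τ‖ ^ 2) * G x
      = Complex.exp (-(1 / 2 * (‖τ‖ ^ 2 : ℝ))) *
        ((starRingEnd ℂ) (Complex.exp (1 / 2 * ext (T.herm τ) x)) * ψ x) := fun x => by
      rw [← hexp, sub_eq_neg_add, Complex.exp_add, mul_assoc, innerSL_apply_norm]
      congr 2
      simp
    simp only [h3] at h2
    rw [integral_const_mul] at h2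
    simp only [G, ext_incl, herm_self] at h2
    rw [inner_holCoherentLp, mul_left_cancel₀ (Complex.exp_ne_zero _) h2]
    refine integral_congr_ae ?_
    filter_upwards [hu] with x hx
    rw [hx]
  · intro x
    simp only [G, ext_add_right, T.ext_hatCmul (T.herm_J τ)]
    exact Differentiable.mul (by fun_prop) (hd x)

theorem inner_holCoherentLp_holCoherentLp (τ σ : L) :
    ⟪T.holCoherentLp τ, T.holCoherentLp σ⟫_ℂ = T.holCoherent σ τ := by
  rw [T.inner_holCoherentLp_eq τ (T.holCoherentLp_ae_eq σ)
    (Complex.measurable_exp.comp ((measurable_ext (T.herm σ)).const_mul _)), ext_incl, holCoherent]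
  intro x
  simp only [ext_add_right, T.ext_hatCmul (T.herm_J σ)]
  fun_prop

theorem norm_holCoherentLp (τ : L) : ‖T.holCoherentLp τ‖ = Real.exp (1 / 4 * ‖τ‖ ^ 2) := by
  have h := inner_self_eq_norm_sq_to_K (𝕜 := ℂ) (T.holCoherentLp τ)
  rw [inner_holCoherentLp_holCoherentLp, holCoherent, herm_self] at h
  have h2 : Real.exp (1 / 2 * ‖τ‖ ^ 2) = ‖T.holCoherentLp τ‖ ^ 2 := by
    have h3 : ((Real.exp (1 / 2 * ‖τ‖ ^ 2) : ℝ) : ℂ) = ((‖T.holCoherentLp τ‖ ^ 2 : ℝ) : ℂ) := by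
      push_cast
      simpa using h
    exact Complex.ofReal_injective h3
  have h4 : Real.exp (1 / 2 * ‖τ‖ ^ 2) = Real.exp (1 / 4 * ‖τ‖ ^ 2) ^ 2 := by
    rw [← Real.exp_nat_mul]
    congr 1
    push_cast; ring
  rw [h4] at h2
  exact ((pow_left_inj₀ (by positivity) (by positivity) two_ne_zero).1 h2).symm

/-- Wave functions are holomorphic on complex lines. -/
theorem differentiable_inner_holCoherentLp {u : Lp ℂ 2 T.nuL}
    (hu : u ∈ (Submodule.span ℂ (Set.range T.holCoherentLp)).topologicalClosure) (σ τ : L) :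
    Differentiable ℂ fun z : ℂ => ⟪T.holCoherentLp (σ + T.cmul z τ), u⟫_ℂ := by
  have hspan : ∀ w ∈ Submodule.span ℂ (Set.range T.holCoherentLp),
      Differentiable ℂ fun z : ℂ => ⟪T.holCoherentLp (σ + T.cmul z τ), w⟫_ℂ := by
    intro w hw
    induction hw using Submodule.span_induction with
    | mem w hw =>
      obtain ⟨ρ, rfl⟩ := hw
      simp only [inner_holCoherentLp_holCoherentLp, holCoherent, map_add, herm_cmul_right]
      fun_prop
    | zero => simp
    | add v w _ _ hv hw =>
      simp only [inner_add_right]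
      exact hv.add hw
    | smul c w _ hw =>
      simp only [inner_smul_right]
      exact hw.const_mul c
  obtain ⟨w, hw, hlim⟩ := mem_closure_iff_seq_limit.1 hu
  rw [← differentiableOn_univ]
  refine TendstoLocallyUniformlyOn.differentiableOn (φ := atTop)
    (F := fun n (z : ℂ) => ⟪T.holCoherentLp (σ + T.cmul z τ), w n⟫_ℂ) ?_
    (Eventually.of_forall fun n => (hspan _ (hw n)).differentiableOn) isOpen_univ
  rw [tendstoLocallyUniformlyOn_univ, tendstoLocallyUniformly_iff_forall_isCompact]
  intro K hK
  obtain ⟨R, hR⟩ := hK.isBounded.exists_norm_le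
  -- The norms of the coherent states are bounded on compact sets of parameters, so norm convergence
  -- of states gives locally uniform convergence of wave functions, which preserves holomorphy.
  have hb : ∀ z ∈ K, ‖T.holCoherentLp (σ + T.cmul z τ)‖
      ≤ Real.exp (1 / 4 * (‖σ‖ + R * ‖τ‖) ^ 2) := fun z hz => by
    rw [norm_holCoherentLp]
    have h1 : ‖σ + T.cmul z τ‖ ≤ ‖σ‖ + R * ‖τ‖ := by
      refine (norm_add_le _ _).trans ?_
      rw [norm_cmul]
      gcongr
      exact hR z hz
    gcongr
  have h0 : Tendsto (fun n => Real.exp (1 / 4 * (‖σ‖ + R * ‖τ‖) ^ 2) * ‖u - w n‖) atTop (𝓝 0) := by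
    have := (tendsto_iff_norm_sub_tendsto_zero.1 hlim).const_mul
      (Real.exp (1 / 4 * (‖σ‖ + R * ‖τ‖) ^ 2))
    simpa [norm_sub_rev] using this
  rw [Metric.tendstoUniformlyOn_iff]
  intro ε hε
  filter_upwards [h0.eventually (gt_mem_nhds hε)] with n hn z hz
  refine lt_of_le_of_lt ?_ hn
  rw [dist_eq_norm, ← inner_sub_right]
  refine (norm_inner_le_norm _ _).trans ?_
  gcongr
  exact hb z hz

end FieldTheory
-- Density of the coherent states in the holomorphic Hilbert space.
namespace FieldTheory

variable {L : Type*} [NormedAddCommGroup L] [InnerProductSpace ℝ L] (T : FieldTheory L)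

/-- For `e` orthonormal with respect to `{·,·}`, the projection of `Hat L` to the complex span
of `e`. -/
def hatProj {m : ℕ} (e : Fin m → L) (x : Hat L) : L :=
  ∑ k, T.cmul (ext (T.herm (e k)) x) (e k)

section hatProj
variable {m : ℕ} {e : Fin m → L}

theorem hatProj_add_hatCmul (x y : Hat L) (z : ℂ) :
    T.hatProj e (T.hatCmul z x + y) = T.hatProj e y + T.cmul z (T.hatProj e x) := by
  simp only [hatProj, map_sum, ← Finset.sum_add_distrib, ← cmul_cmul]
  refine Finset.sum_congr rfl fun k _ => ?_
  rw [ext_add_right, T.ext_hatCmul (T.herm_J _)]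
  simp only [cmul_apply, Complex.add_re, Complex.add_im]
  module

theorem herm_hatProj (τ : L) (x : Hat L) :
    T.herm τ (T.hatProj e x) = ∑ k, ext (T.herm (e k)) x * T.herm τ (e k) := by
  simp only [hatProj, map_sum, herm_cmul_right]

theorem herm_orthonormal_hatProj (he : ∀ j k, T.herm (e j) (e k) = if j = k then 1 else 0)
    (j : Fin m) (x : Hat L) : T.herm (e j) (T.hatProj e x) = ext (T.herm (e j)) x := by
  simp [herm_hatProj, he]

theorem herm_hatProj_left (y : Hat L) : T.herm (T.hatProj e y)
    = ∑ k, (starRingEnd ℂ) (ext (T.herm (e k)) y) • T.herm (e k) := by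
  ext ξ
  rw [← herm_conj_symm, herm_hatProj, map_sum, sum_apply]
  refine Finset.sum_congr rfl fun k _ => ?_
  rw [FunLike.coe_smul, Pi.smul_apply, map_mul, herm_conj_symm, smul_eq_mul]

/-- A coherent state with parameter in the span of `e` sees only the projection of its argument, so
its extension to `Hat L` can be evaluated on `L` itself. -/
theorem ext_herm_hatProj (he : ∀ j k, T.herm (e j) (e k) = if j = k then 1 else 0)
    (x y : Hat L) :
    ext (T.herm (T.hatProj e y)) x = T.herm (T.hatProj e y) (T.hatProj e x) := by
  rw [herm_hatProj_left, ext_sum, sum_apply]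
  refine Finset.sum_congr rfl fun k _ => ?_
  rw [ext_smul, FunLike.coe_smul, Pi.smul_apply, T.herm_orthonormal_hatProj he, smul_eq_mul]

end hatProj

variable [CompleteSpace L]

/-- The wave function, composed with the projection, is a pointwise representative. This is the
reproducing property on generators, and it passes to limits along an almost everywhere convergent
subsequence. -/
theorem inner_hatProj_ae_eq {m : ℕ} {e : Fin m → L}
    (he : ∀ j k, T.herm (e j) (e k) = if j = k then 1 else 0) {w : Lp ℂ 2 T.nuL}
    (hw : w ∈ (Submodule.span ℂ
      (Set.range fun y => T.holCoherentLp (T.hatProj e y))).topologicalClosure) :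
    (Measurable fun x => ⟪T.holCoherentLp (T.hatProj e x), w⟫_ℂ) ∧
      w =ᵐ[T.nuL] fun x => ⟪T.holCoherentLp (T.hatProj e x), w⟫_ℂ := by
  have hspan : ∀ w ∈ Submodule.span ℂ (Set.range fun y => T.holCoherentLp (T.hatProj e y)),
      (Measurable fun x => ⟪T.holCoherentLp (T.hatProj e x), w⟫_ℂ) ∧
        w =ᵐ[T.nuL] fun x => ⟪T.holCoherentLp (T.hatProj e x), w⟫_ℂ := by
    intro w hw
    induction hw using Submodule.span_induction with
    | mem w hw =>
      obtain ⟨y, rfl⟩ := hw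
      simp only [inner_holCoherentLp_holCoherentLp, holCoherent, ← T.ext_herm_hatProj he]
      exact ⟨Complex.measurable_exp.comp ((measurable_ext _).const_mul _),
        T.holCoherentLp_ae_eq _⟩
    | zero =>
      simp only [inner_zero_right]
      exact ⟨measurable_const, Lp.coeFn_zero ℂ 2 T.nuL⟩
    | add v w _ _ hv hw =>
      simp only [inner_add_right]
      exact ⟨hv.1.add hw.1, (Lp.coeFn_add v w).trans (hv.2.add hw.2)⟩
    | smul c w _ hw =>
      simp only [inner_smul_right]
      exact ⟨hw.1.const_mul c, (Lp.coeFn_smul c w).trans (hw.2.const_smul c)⟩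
  obtain ⟨v, hv, hlim⟩ := mem_closure_iff_seq_limit.1 hw
  have hpt : ∀ x, Tendsto (fun n => ⟪T.holCoherentLp (T.hatProj e x), v n⟫_ℂ) atTop
      (𝓝 ⟪T.holCoherentLp (T.hatProj e x), w⟫_ℂ) := fun x => tendsto_const_nhds.inner hlim
  refine ⟨measurable_of_tendsto_metrizable (fun n => (hspan _ (hv n)).1)
    (tendsto_pi_nhds.2 hpt), ?_⟩
  obtain ⟨s, hs, hae⟩ := (tendstoInMeasure_of_tendsto_Lp hlim).exists_seq_tendsto_ae
  filter_upwards [hae, ae_all_iff.2 fun n => (hspan _ (hv n)).2] with x h1 h2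
  refine tendsto_nhds_unique h1 ?_
  simp only [h2]
  exact (hpt x).comp hs.tendsto_atTop

/-- The coherent states span a dense subspace of the holomorphic functions. -/
theorem HH_le_closure_span :
    T.HH ≤ (Submodule.span ℂ (Set.range T.holCoherentLp)).topologicalClosure := by
  refine Submodule.topologicalClosure_minimal _ ?_ (Submodule.isClosed_topologicalClosure _)
  refine Submodule.span_le.2 ?_
  rintro u ⟨ψ, ⟨n, l, h, hl, hh, rfl⟩, hu⟩
  obtain ⟨m, e, he, hle⟩ := T.exists_orthonormal_expansion l hl
  let W := (Submodule.span ℂ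
    (Set.range fun y => T.holCoherentLp (T.hatProj e y))).topologicalClosure
  have hWK : W ≤ (Submodule.span ℂ (Set.range T.holCoherentLp)).topologicalClosure := by
    refine Submodule.topologicalClosure_mono (Submodule.span_mono ?_)
    rintro _ ⟨y, rfl⟩
    exact ⟨_, rfl⟩
  have : CompleteSpace W := (Submodule.isClosed_topologicalClosure _).completeSpace_coe
  let w : Lp ℂ 2 T.nuL := W.starProjection u
  have hw : w ∈ W := W.starProjection_apply_mem u
  obtain ⟨hUm, hUae⟩ := T.inner_hatProj_ae_eq he hw
  -- A pointwise representative of `u - w`, defined everywhere so that it can be evaluated at the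
  -- points of `L`, which need not have positive measure.
  let D : Hat L → ℂ := fun x =>
    h (fun i => ext (l i) x) - ⟪T.holCoherentLp (T.hatProj e x), w⟫_ℂ
  have hDm : Measurable D := (hh.continuous.measurable.comp
    (measurable_pi_lambda _ fun i => measurable_ext (l i))).sub hUm
  have hD : (u - w : Lp ℂ 2 T.nuL) =ᵐ[T.nuL] D := (Lp.coeFn_sub u w).trans (hu.sub hUae)
  -- The value of `D` at a projected point is the inner product of a generator of `W` with `u - w`,
  -- which is orthogonal to `W`.
  have hD0 : ∀ x, D (incl (T.hatProj e x)) = 0 := fun x => by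
    rw [← T.inner_holCoherentLp_eq (T.hatProj e x) hD hDm]
    · exact W.sub_starProjection_mem_orthogonal u _
        (Submodule.le_topologicalClosure _ (Submodule.subset_span ⟨x, rfl⟩))
    · intro y
      simp only [D, hatProj_add_hatCmul]
      refine Differentiable.sub ?_ (T.differentiable_inner_holCoherentLp (hWK hw) _ _)
      refine hh.comp (differentiable_pi.2 fun i => ?_)
      simp only [ext_add_right, T.ext_hatCmul (hl i)]
      fun_prop
  have hproj : ∀ x, D x = D (incl (T.hatProj e x)) := fun x => by
    have h1 : ∀ i, ext (l i) x = ext (l i) (incl (T.hatProj e x)) := fun i => by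
      rw [ext_incl, hle i, ext_sum, sum_apply]
      refine Finset.sum_congr rfl fun k _ => ?_
      rw [ext_smul, FunLike.coe_smul, Pi.smul_apply, T.herm_orthonormal_hatProj he, smul_eq_mul]
    have h2 : T.hatProj e (incl (T.hatProj e x)) = T.hatProj e x := by
      conv_lhs => rw [hatProj]
      simp only [ext_incl, T.herm_orthonormal_hatProj he]
      rfl
    simp only [D, h1, h2]
  have huw : u = w := by
    rw [← sub_eq_zero]
    have h0 : D = 0 := funext fun x => (hproj x).trans (hD0 x)
    rw [h0] at hD
    exact Lp.ext (hD.trans (Lp.coeFn_zero _ _ _).symm)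
  rw [SetLike.mem_coe, huw]
  exact hWK hw

theorem mem_HH_eq_zero {u : T.HH} (h : ∀ τ, ⟪T.holCoherentState τ, u⟫_ℂ = 0) : u = 0 := by
  have h1 : (Submodule.span ℂ (Set.range T.holCoherentLp)).topologicalClosure
      ≤ (ℂ ∙ (u : Lp ℂ 2 T.nuL))ᗮ := by
    refine Submodule.topologicalClosure_minimal _ (Submodule.span_le.2 ?_)
      (Submodule.isClosed_orthogonal _)
    rintro _ ⟨τ, rfl⟩
    rw [SetLike.mem_coe, Submodule.mem_orthogonal_singleton_iff_inner_left]
    exact h τ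
  have h2 := h1 (T.HH_le_closure_span u.2)
  rw [Submodule.mem_orthogonal_singleton_iff_inner_left, inner_self_eq_zero] at h2
  exact Subtype.ext h2

theorem wave_injective : Function.Injective T.wave := by
  refine (injective_iff_map_eq_zero T.wave).2 fun u hu => T.mem_HH_eq_zero fun τ => ?_
  rw [← wave_apply, hu]
  rfl

theorem differentiable_wave (u : T.HH) (σ τ : L) :
    Differentiable ℂ fun z : ℂ => T.wave u (σ + T.cmul z τ) :=
  T.differentiable_inner_holCoherentLp (T.HH_le_closure_span u.2) σ τ

end FieldTheory

/-! ### Families of vectors with equal Gram matrices. -/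

section gram
variable {ι V W : Type*} [NormedAddCommGroup V] [InnerProductSpace ℂ V]
  [NormedAddCommGroup W] [InnerProductSpace ℂ W] {k : ι → V} {k' : ι → W}

theorem norm_linearCombination_eq_of_inner_eq (h : ∀ i j, ⟪k' i, k' j⟫_ℂ = ⟪k i, k j⟫_ℂ)
    (c : ι →₀ ℂ) :
    ‖Finsupp.linearCombination ℂ k' c‖ = ‖Finsupp.linearCombination ℂ k c‖ := by
  rw [← sq_eq_sq₀ (norm_nonneg _) (norm_nonneg _), ← Complex.ofReal_inj]
  push_cast
  rw [← Complex.coe_algebraMap, ← inner_self_eq_norm_sq_to_K (𝕜 := ℂ),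
    ← inner_self_eq_norm_sq_to_K (𝕜 := ℂ)]
  simp only [Finsupp.linearCombination_apply, Finsupp.sum, sum_inner, inner_sum, inner_smul_left,
    inner_smul_right, h]

variable [CompleteSpace V]

theorem denseRange_linearCombination (hk : ∀ u : V, (∀ i, ⟪k i, u⟫_ℂ = 0) → u = 0) :
    DenseRange (Finsupp.linearCombination ℂ k) := by
  have h : (LinearMap.range (Finsupp.linearCombination ℂ k)).topologicalClosure = ⊤ := by
    rw [Submodule.topologicalClosure_eq_top_iff, Finsupp.range_linearCombination, eq_bot_iff]
    intro u hu
    exact hk u fun i => hu _ (Submodule.subset_span ⟨i, rfl⟩)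
  have h2 := Submodule.dense_iff_topologicalClosure_eq_top.2 h
  exact h2

variable [CompleteSpace W]

/-- Total families with equal Gram matrices are related by a unique isometric isomorphism. -/
theorem existsUnique_linearIsometryEquiv (h : ∀ i j, ⟪k' i, k' j⟫_ℂ = ⟪k i, k j⟫_ℂ)
    (hk : ∀ u : V, (∀ i, ⟪k i, u⟫_ℂ = 0) → u = 0)
    (hk' : ∀ u : W, (∀ i, ⟪k' i, u⟫_ℂ = 0) → u = 0) :
    ∃ B : V ≃ₗᵢ[ℂ] W, (∀ i, B (k i) = k' i) ∧
      ∀ B' : V ≃ₗᵢ[ℂ] W, (∀ i, B' (k i) = k' i) → B' = B := by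
  have d := denseRange_linearCombination hk
  -- Equal Gram matrices make the identity on coefficients isometric between two dense images, so it
  -- extends to the completions.
  let B := (LinearEquiv.refl ℂ (ι →₀ ℂ)).extendOfIsometry (Finsupp.linearCombination ℂ k)
    (Finsupp.linearCombination ℂ k') d (denseRange_linearCombination hk')
    (norm_linearCombination_eq_of_inner_eq h)
  have hB : ∀ i, B (k i) = k' i := fun i => by
    have := LinearEquiv.extendOfIsometry_eq (LinearEquiv.refl ℂ (ι →₀ ℂ))
      (Finsupp.linearCombination ℂ k)
      (Finsupp.linearCombination ℂ k') d (denseRange_linearCombination hk')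
      (norm_linearCombination_eq_of_inner_eq h) (Finsupp.single i 1)
    simpa using this
  refine ⟨B, hB, fun B' hB' => LinearIsometryEquiv.ext fun u => ?_⟩
  refine congrFun (d.equalizer B'.continuous B.continuous (funext fun c => ?_)) u
  simp [Finsupp.linearCombination_apply, Finsupp.sum, hB, hB']

end gram

/-! ### Overlaps and totality of the Schrödinger coherent states, and the isometry. -/

namespace FieldTheory

variable {L : Type*} [NormedAddCommGroup L] [InnerProductSpace ℝ L] (T : FieldTheory L)

/-- For `m ∈ M` the second half of `2 ω(m, ξ)` drops out. -/
theorem bracket_of_mem_M {m : L} (hm : m ∈ T.M) (ξ : L) : T.bracket m ξ = ⟪T.J m, ξ⟫_ℝ := by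
  rw [inner_J_left, omega_apply, T.mem_M.1 hm ξ]
  ring

theorem inner_J_of_mem_M {m m' : L} (hm : m ∈ T.M) (hm' : m' ∈ T.M) : ⟪T.J m, m'⟫_ℝ = 0 := by
  rw [← T.bracket_of_mem_M hm, T.mem_M.1 hm']

theorem inner_of_mem_JM {a m : L} (ha : a ∈ T.JM) (hm : m ∈ T.M) : ⟪a, m⟫_ℝ = 0 := by
  obtain ⟨m', hm', rfl⟩ := ha
  exact T.inner_J_of_mem_M hm' hm

theorem inner_J_of_mem_JM {a a' : L} (ha : a ∈ T.JM) (ha' : a' ∈ T.JM) : ⟪T.J a, a'⟫_ℝ = 0 := by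
  obtain ⟨m', hm', rfl⟩ := ha'
  rw [inner_J_J]
  exact T.inner_of_mem_JM ha hm'

/-- Real part of the logarithm of the overlap of `τ = a + m` and `σ = b + n`. The factor `1 / 4` is
half the variance `1 / 2` of `nuQ`; the mixed terms vanish as `M` and `JM` are orthogonal. -/
theorem coherent_overlap_re {a b m n : L} (ha : a ∈ T.JM) (hb : b ∈ T.JM) (hm : m ∈ T.M)
    (hn : n ∈ T.M) :
    1 / 4 * (‖a + b‖ ^ 2 - ‖T.J n - T.J m‖ ^ 2) - 1 / 2 * ‖a‖ ^ 2 - 1 / 2 * ‖b‖ ^ 2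
      = -(1 / 4) * (‖a + m‖ ^ 2 + ‖b + n‖ ^ 2) + 1 / 2 * ⟪b + n, a + m⟫_ℝ := by
  simp only [norm_add_sq_real, norm_sub_sq_real, inner_add_left, inner_add_right, T.norm_J,
    T.inner_J_J, T.inner_of_mem_JM ha hm, T.inner_of_mem_JM hb hn, T.inner_of_mem_JM hb hm,
    real_inner_comm a n, T.inner_of_mem_JM ha hn, real_inner_comm b a]
  ring

/-- The corresponding imaginary part, which uses that both `M` and `JM` are isotropic for `ω`. -/
theorem coherent_overlap_im {a b m n : L} (ha : a ∈ T.JM) (hb : b ∈ T.JM) (hm : m ∈ T.M)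
    (hn : n ∈ T.M) :
    1 / 2 * ⟪a + b, T.J n - T.J m⟫_ℝ + 1 / 2 * ⟪T.J m, a⟫_ℝ - 1 / 2 * ⟪T.J n, b⟫_ℝ
      = 1 / 2 * ⟪T.J (b + n), a + m⟫_ℝ := by
  have h : ⟪T.J b, m⟫_ℝ = -⟪b, T.J m⟫_ℝ := by rw [inner_J_left, inner_J_right, neg_neg]
  simp only [inner_add_left, inner_sub_right, inner_add_right, map_add, T.inner_J_of_mem_M hn hm,
    T.inner_J_of_mem_JM hb ha, h, real_inner_comm a (T.J m), real_inner_comm b (T.J n),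
    real_inner_comm a (T.J n)]
  ring

variable [CompleteSpace L]

theorem j_mem (φ : T.Q) : T.j φ ∈ T.JM := T.jLin_mem φ

theorem q_j (φ : T.Q) : T.q (T.j φ) = φ := T.q_jLin φ

theorem sub_j_q_mem (τ : L) : τ - T.j (T.q τ) ∈ T.M := T.jLin_q_sub_mem τ

theorem inner_j_q {a : L} (ha : a ∈ T.JM) (ξ : L) : ⟪a, T.j (T.q ξ)⟫_ℝ = ⟪a, ξ⟫_ℝ := by
  have := T.inner_of_mem_JM ha (T.sub_j_q_mem ξ)
  rw [inner_sub_right] at this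
  linarith

theorem dualEmbedding_eq {f : StrongDual ℝ T.Q} {a : L} (h : ∀ ξ, f (T.q ξ) = ⟪a, ξ⟫_ℝ) :
    T.dualEmbedding f = a := by
  change (InnerProductSpace.toDual ℝ L).symm (f.comp T.M.mkQL) = a
  rw [LinearIsometryEquiv.symm_apply_eq]
  ext ξ
  exact h ξ

theorem inner_dualEmbedding (f : StrongDual ℝ T.Q) (ξ : L) :
    ⟪T.dualEmbedding f, ξ⟫_ℝ = f (T.q ξ) :=
  InnerProductSpace.toDual_symm_apply

/-- The exponent of `k_τ`, up to a constant. -/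
def schrExponent (τ : L) : T.Q →L[ℝ] ℂ :=
  T.Omega (T.q τ) + Complex.I • Complex.ofRealCLM.comp (T.bracketQ τ)

/-- The logarithm of the normalization factor of `k_τ`. -/
def schrConst (τ : L) : ℂ :=
  -(1 / 2) * T.Omega (T.q τ) (T.q τ) - Complex.I / 2 * T.bracket τ τ

theorem schrCoherent_apply (τ : L) (φ : Hat T.Q) :
    T.schrCoherent τ φ = Complex.exp (ext (T.schrExponent τ) φ + T.schrConst τ) := rfl

/-- The real part of the exponent of `k_τ`. -/
def schrRe (τ : L) : StrongDual ℝ T.Q := (innerSL ℝ (T.j (T.q τ))).comp T.j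

/-- The imaginary part of the exponent of `k_τ`. -/
def schrIm (τ : L) : StrongDual ℝ T.Q := T.bracketQ (τ - T.j (T.q τ))

theorem schrIm_apply_q (τ ξ : L) : T.schrIm τ (T.q ξ) = ⟪T.J (τ - T.j (T.q τ)), ξ⟫_ℝ := by
  rw [schrIm, bracketQ_q, T.bracket_of_mem_M (T.sub_j_q_mem τ)]

theorem dualEmbedding_schrRe (τ : L) : T.dualEmbedding (T.schrRe τ) = T.j (T.q τ) :=
  T.dualEmbedding_eq fun ξ => T.inner_j_q (T.j_mem _) ξ

theorem dualEmbedding_schrIm (τ : L) :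
    T.dualEmbedding (T.schrIm τ) = T.J (τ - T.j (T.q τ)) :=
  T.dualEmbedding_eq (T.schrIm_apply_q τ)

/-- The imaginary part of `Ω(qτ, ·)` cancels the contribution of `j (q τ)` to `[τ, ·]`; only the
`M`-component of `τ` survives in the phase. -/
theorem ext_schrExponent (τ : L) (φ : Hat T.Q) :
    ext (T.schrExponent τ) φ = (φ (T.schrRe τ) : ℂ) + φ (T.schrIm τ) * Complex.I := by
  have h : T.schrExponent τ = Complex.ofRealCLM.comp (T.schrRe τ)
      + Complex.I • Complex.ofRealCLM.comp (T.schrIm τ) := by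
    ext φ
    obtain ⟨ξ, rfl⟩ := T.M.mkQ_surjective φ
    simp only [schrExponent, schrRe, schrIm, add_apply, Omega_apply, FunLike.coe_smul, Pi.smul_apply,
      ContinuousLinearMap.comp_apply, Complex.ofRealCLM_apply, smul_eq_mul, innerSL_apply_apply]
    rw [bracketQ_q, bracketQ_q, bracketQ_q, map_sub, sub_apply]
    push_cast
    ring
  rw [h, ext_add, ext_smul, ext_ofReal_comp, ext_ofReal_comp, mul_comm Complex.I]

theorem schrConst_eq (τ : L) : T.schrConst τ = (-(1 / 2) * ‖T.j (T.q τ)‖ ^ 2 : ℝ)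
    - (1 / 2 * ⟪T.J (τ - T.j (T.q τ)), T.j (T.q τ)⟫_ℝ : ℝ) * Complex.I := by
  have h1 := T.inner_J_of_mem_M (T.sub_j_q_mem τ) (T.sub_j_q_mem τ)
  rw [inner_sub_right, ← T.bracket_of_mem_M (T.sub_j_q_mem τ)] at h1
  rw [← sub_eq_zero.1 h1, schrConst, Omega_apply, bracketQ_q, real_inner_self_eq_norm_sq, map_sub,
    sub_apply]
  push_cast
  ring

theorem schrCoherentState_ae_eq (τ : L) :
    T.schrCoherentState τ =ᵐ[T.nuQ] T.schrCoherent τ := MemLp.coeFn_toLp _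

theorem inner_schrCoherentState (τ : L) (u : T.HS) :
    ⟪T.schrCoherentState τ, u⟫_ℂ
      = ∫ φ, (starRingEnd ℂ) (T.schrCoherent τ φ) * u φ ∂T.nuQ := by
  rw [L2.inner_def]
  refine integral_congr_ae ?_
  filter_upwards [T.schrCoherentState_ae_eq τ] with x hx
  rw [hx, RCLike.inner_apply, mul_comm]

/-- The integral is computed through the splitting `L = M + JM`, but the components recombine into
an expression in which `M` no longer appears. Hence it can match the holomorphic Gram matrix. -/
theorem inner_schrCoherentState_schrCoherentState (τ σ : L) :
    ⟪T.schrCoherentState τ, T.schrCoherentState σ⟫_ℂ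
      = Complex.exp (-(1 / 4) * (‖τ‖ ^ 2 + ‖σ‖ ^ 2) + 1 / 2 * T.herm σ τ) := by
  have h1 : ⟪T.schrCoherentState τ, T.schrCoherentState σ⟫_ℂ
      = ∫ φ : Hat T.Q, Complex.exp ((φ (T.schrRe τ + T.schrRe σ) : ℂ)
          + φ (T.schrIm σ - T.schrIm τ) * Complex.I)
        * Complex.exp ((starRingEnd ℂ) (T.schrConst τ) + T.schrConst σ) ∂T.nuQ := by
    rw [inner_schrCoherentState]
    refine integral_congr_ae ?_
    filter_upwards [T.schrCoherentState_ae_eq σ] with φ hφ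
    rw [hφ, schrCoherent_apply, schrCoherent_apply, ← Complex.exp_conj, ← Complex.exp_add,
      ← Complex.exp_add, ext_schrExponent, ext_schrExponent]
    congr 1
    simp only [map_add, map_sub, map_mul, Complex.conj_ofReal, Complex.conj_I]
    push_cast
    ring
  rw [h1, integral_mul_const, T.isHatGaussian_nuQ.integral_exp_add_mul_I T.dualEmbedding,
    ← Complex.exp_add]
  congr 1
  rw [T.dualEmbedding.map_add, T.dualEmbedding.map_sub]
  simp only [dualEmbedding_schrRe, dualEmbedding_schrIm, schrConst_eq]
  have hτ := T.sub_j_q_mem τ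
  have hσ := T.sub_j_q_mem σ
  have haτ := T.j_mem (T.q τ)
  have haσ := T.j_mem (T.q σ)
  have eτ : T.j (T.q τ) + (τ - T.j (T.q τ)) = τ := by abel
  have eσ : T.j (T.q σ) + (σ - T.j (T.q σ)) = σ := by abel
  rw [T.herm_eq_inner]
  generalize τ - T.j (T.q τ) = m at *
  generalize σ - T.j (T.q σ) = n at *
  generalize T.j (T.q τ) = a at *
  generalize T.j (T.q σ) = b at *
  have hre := T.coherent_overlap_re haτ haσ hτ hσ
  have him := T.coherent_overlap_im haτ haσ hτ hσ
  rw [eτ, eσ] at hre him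
  have hre' := congrArg (fun x : ℝ => (x : ℂ)) hre
  have him' := congrArg (fun x : ℝ => (x : ℂ)) him
  simp only [map_sub, map_mul, Complex.conj_ofReal, Complex.conj_I] at hre' him' ⊢
  push_cast at hre' him' ⊢
  linear_combination hre' + Complex.I * him'

/-- Testing against the states with parameter in `M` suffices, because they are the characters of
`Hat Q` up to constants. -/
theorem mem_HS_eq_zero {u : T.HS} (h : ∀ τ, ⟪T.schrCoherentState τ, u⟫_ℂ = 0) : u = 0 := by
  have := T.isHatGaussian_nuQ.isProbabilityMeasure
  have hu : Integrable u T.nuQ := (Lp.memLp u).integrable (by norm_num)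
  refine Lp.ext ((ae_eq_zero_of_integral_exp_mul hu fun f => ?_).trans (Lp.coeFn_zero _ _ _).symm)
  have hb : T.dualEmbedding f ∈ T.JM := by
    rw [JM_eq, Submodule.mem_orthogonal]
    intro m hm
    rw [real_inner_comm, inner_dualEmbedding, show T.q m = 0 from (Submodule.Quotient.mk_eq_zero _).2 hm, map_zero]
  -- The Riesz vector of `f` is orthogonal to `M`, hence equal to `J m`. The parameter is `-m`
  -- because the inner product conjugates the phase.
  obtain ⟨m, hm, hmb⟩ := hb
  have hq : T.q (-m) = 0 := (Submodule.Quotient.mk_eq_zero _).2 (T.M.neg_mem hm)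
  have hre : T.schrRe (-m) = 0 := by
    rw [schrRe, hq, map_zero, map_zero, ContinuousLinearMap.zero_comp]
  have him : T.schrIm (-m) = -f := by
    ext φ
    obtain ⟨ξ, rfl⟩ := T.M.mkQ_surjective φ
    change T.schrIm (-m) (T.q ξ) = _
    rw [schrIm_apply_q, hq, map_zero, sub_zero, map_neg, inner_neg_left, hmb, inner_dualEmbedding]
    rfl
  have h1 := h (-m)
  rw [inner_schrCoherentState] at h1
  have h2 : ∀ φ : Hat T.Q, (starRingEnd ℂ) (T.schrCoherent (-m) φ) * u φ
      = (starRingEnd ℂ) (Complex.exp (T.schrConst (-m))) *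
        (Complex.exp (φ f * Complex.I) * u φ) := fun φ => by
    rw [schrCoherent_apply, ext_schrExponent, hre, him, Complex.exp_add, map_mul,
      ← Complex.exp_conj _]
    simp
    ring
  simp only [h2] at h1
  rw [integral_const_mul] at h1
  refine (mul_eq_zero.1 h1).resolve_left ?_
  simp

theorem inner_holNormalizedState (τ : L) (u : T.HH) :
    ⟪T.holNormalizedState τ, u⟫_ℂ
      = Complex.exp (-(1 / 4) * (‖τ‖ ^ 2 : ℝ)) * ⟪T.holCoherentState τ, u⟫_ℂ := by
  refine (inner_smul_left (T.holCoherentState τ) u _).trans ?_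
  rw [← Complex.exp_conj, real_inner_self_eq_norm_sq]
  congr 2
  simp [Complex.conj_ofNat]

theorem inner_holNormalizedState_holNormalizedState (τ σ : L) :
    ⟪T.holNormalizedState τ, T.holNormalizedState σ⟫_ℂ
      = ⟪T.schrCoherentState τ, T.schrCoherentState σ⟫_ℂ := by
  have h : ⟪T.holCoherentState τ, T.holNormalizedState σ⟫_ℂ
      = Complex.exp (-(1 / 4) * (⟪σ, σ⟫_ℝ : ℂ)) * ⟪T.holCoherentLp τ, T.holCoherentLp σ⟫_ℂ :=
    inner_smul_right (T.holCoherentState τ) (T.holCoherentState σ) _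
  rw [inner_schrCoherentState_schrCoherentState, inner_holNormalizedState, h]
  rw [inner_holCoherentLp_holCoherentLp, holCoherent, ← Complex.exp_add, ← Complex.exp_add,
    real_inner_self_eq_norm_sq]
  congr 1
  push_cast
  ring

theorem exists_isometry : ∃ B : T.HS ≃ₗᵢ[ℂ] T.HH,
    (∀ τ, B (T.schrCoherentState τ) = T.holNormalizedState τ) ∧
      ∀ B' : T.HS ≃ₗᵢ[ℂ] T.HH, (∀ τ, B' (T.schrCoherentState τ) = T.holNormalizedState τ) →
        B' = B := by
  have : CompleteSpace T.HH := (Submodule.isClosed_topologicalClosure _).completeSpace_coe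
  refine existsUnique_linearIsometryEquiv T.inner_holNormalizedState_holNormalizedState
    (fun u => T.mem_HS_eq_zero) fun u hu => T.mem_HH_eq_zero fun τ => ?_
  have h := hu τ
  rw [inner_holNormalizedState] at h
  exact (mul_eq_zero.1 h).resolve_left (Complex.exp_ne_zero _)

end FieldTheory

/-! ### Exponential polynomials and differentiation under the Gaussian integral. -/

section expPoly
variable {E : Type*} [SeminormedAddCommGroup E] [NormedSpace ℝ E]

/-- Linear combinations of products of continuous linear functionals with an exponential of a
continuous linear functional. -/
inductive IsExpPoly : (Hat E → ℂ) → Prop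
  | exp (l : E →L[ℝ] ℂ) (c : ℂ) : IsExpPoly fun x => Complex.exp (ext l x + c)
  | ext_mul (l : E →L[ℝ] ℂ) {ψ : Hat E → ℂ} : IsExpPoly ψ → IsExpPoly fun x => ext l x * ψ x
  | add {ψ χ : Hat E → ℂ} : IsExpPoly ψ → IsExpPoly χ → IsExpPoly fun x => ψ x + χ x
  | const_mul (c : ℂ) {ψ : Hat E → ℂ} : IsExpPoly ψ → IsExpPoly fun x => c * ψ x

/-- The exponential of a sum of absolute values of functionals. -/
def expBound (s : List (StrongDual ℝ E)) (x : Hat E) : ℝ :=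
  Real.exp ((s.map fun f => |x f|).sum)

theorem expBound_nil (x : Hat E) : expBound [] x = 1 := by simp [expBound]

theorem expBound_cons (f : StrongDual ℝ E) (s : List (StrongDual ℝ E)) (x : Hat E) :
    expBound (f :: s) x = Real.exp |x f| * expBound s x := by
  simp [expBound, Real.exp_add]

theorem expBound_append (s t : List (StrongDual ℝ E)) (x : Hat E) :
    expBound (s ++ t) x = expBound s x * expBound t x := by
  simp [expBound, Real.exp_add]

theorem one_le_expBound (s : List (StrongDual ℝ E)) (x : Hat E) : 1 ≤ expBound s x := by
  refine Real.one_le_exp (List.sum_nonneg fun y hy => ?_)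
  obtain ⟨f, -, rfl⟩ := List.mem_map.1 hy
  exact abs_nonneg _

theorem measurable_expBound (s : List (StrongDual ℝ E)) : Measurable (expBound s) := by
  induction s with
  | nil => simp only [funext expBound_nil]; exact measurable_const
  | cons f s ih =>
    simp only [funext (expBound_cons f s)]
    have h : Measurable fun x : Hat E => |x f| := by
      simpa [Real.norm_eq_abs] using (measurable_eval f).norm
    exact (Real.measurable_exp.comp h).mul ih

theorem norm_ext_le_expBound (l : E →L[ℝ] ℂ) (x : Hat E) :
    ‖ext l x‖ ≤ |x (Complex.reCLM.comp l)| + |x (Complex.imCLM.comp l)| := by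
  rw [ext]
  refine (norm_add_le _ _).trans ?_
  rw [norm_mul, Complex.norm_I, mul_one, Complex.norm_real, Complex.norm_real, Real.norm_eq_abs,
    Real.norm_eq_abs]

theorem exp_norm_ext_le_expBound (l : E →L[ℝ] ℂ) (x : Hat E) :
    Real.exp ‖ext l x‖ ≤ expBound [Complex.reCLM.comp l, Complex.imCLM.comp l] x := by
  refine Real.exp_le_exp.2 ?_
  simpa using norm_ext_le_expBound l x

/-- Each `e^{|x f|}` is at most `e^{x f} + e^{-x f}`; the free functional `g` absorbs these factors
in the induction. -/
theorem IsHatGaussian.integrable_expBound_mul {ν : Measure (Hat E)} {v : ℝ≥0}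
    (hν : IsHatGaussian ν v) (s : List (StrongDual ℝ E)) (g : StrongDual ℝ E) :
    Integrable (fun x => expBound s x * Real.exp (x g)) ν := by
  induction s generalizing g with
  | nil => simpa only [expBound_nil, one_mul] using hν.integrable_exp g
  | cons f s ih =>
    refine ((ih (g + f)).add (ih (g - f))).mono' ((measurable_expBound _).mul
      (Real.measurable_exp.comp (measurable_eval g))).aestronglyMeasurable (ae_of_all _ fun x => ?_)
    have h0 : 0 ≤ expBound s x := zero_le_one.trans (one_le_expBound s x)
    rw [expBound_cons, Real.norm_of_nonneg (by positivity), Pi.add_apply, map_add, map_sub,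
      Real.exp_add, sub_eq_add_neg, Real.exp_add]
    have h1 : Real.exp |x f| ≤ Real.exp (x f) + Real.exp (-x f) := by
      rcases abs_choice (x f) with h | h <;> rw [h] <;> linarith [Real.exp_pos (x f), Real.exp_pos (-x f)]
    calc Real.exp |x f| * expBound s x * Real.exp (x g)
        ≤ (Real.exp (x f) + Real.exp (-x f)) * expBound s x * Real.exp (x g) := by gcongr
      _ = _ := by ring

theorem IsHatGaussian.integrable_expBound {ν : Measure (Hat E)} {v : ℝ≥0}
    (hν : IsHatGaussian ν v) (s : List (StrongDual ℝ E)) : Integrable (expBound s) ν := by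
  simpa using hν.integrable_expBound_mul s 0

/-- A family of functions, bounded by an exponential locally uniformly in the parameter. -/
def IsExpBounded (Φ : ℝ → Hat E → ℂ) : Prop :=
  ∃ (C : ℝ) (s : List (StrongDual ℝ E)), 0 ≤ C ∧ ∀ t, |t| ≤ 1 → ∀ x, ‖Φ t x‖ ≤ C * expBound s x

namespace IsExpBounded

theorem mul {Φ Ψ : ℝ → Hat E → ℂ} (hΦ : IsExpBounded Φ) (hΨ : IsExpBounded Ψ) :
    IsExpBounded fun t x => Φ t x * Ψ t x := by
  obtain ⟨C, s, hC, h⟩ := hΦ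
  obtain ⟨D, r, hD, h'⟩ := hΨ
  refine ⟨C * D, s ++ r, by positivity, fun t ht x => ?_⟩
  rw [norm_mul, expBound_append, mul_mul_mul_comm]
  have := one_le_expBound s x
  exact mul_le_mul (h t ht x) (h' t ht x) (norm_nonneg _) (by positivity)

theorem add {Φ Ψ : ℝ → Hat E → ℂ} (hΦ : IsExpBounded Φ) (hΨ : IsExpBounded Ψ) :
    IsExpBounded fun t x => Φ t x + Ψ t x := by
  obtain ⟨C, s, hC, h⟩ := hΦ
  obtain ⟨D, r, hD, h'⟩ := hΨ
  refine ⟨C + D, s ++ r, by positivity, fun t ht x => ?_⟩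
  rw [expBound_append]
  have h1 := one_le_expBound s x
  have h2 := one_le_expBound r x
  calc ‖Φ t x + Ψ t x‖ ≤ C * expBound s x + D * expBound r x :=
        (norm_add_le _ _).trans (add_le_add (h t ht x) (h' t ht x))
    _ ≤ C * (expBound s x * expBound r x) + D * (expBound s x * expBound r x) := by
        gcongr
        · exact le_mul_of_one_le_right (by positivity) h2
        · exact le_mul_of_one_le_left (by positivity) h1
    _ = _ := by ring

theorem const (c : ℂ) : IsExpBounded fun (_ : ℝ) (_ : Hat E) => c :=
  ⟨‖c‖, [], norm_nonneg c, fun t ht x => by simp [expBound_nil]⟩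

theorem param : IsExpBounded fun (t : ℝ) (_ : Hat E) => (t : ℂ) :=
  ⟨1, [], zero_le_one, fun t ht x => by simpa [expBound_nil] using ht⟩

theorem ext (l : E →L[ℝ] ℂ) : IsExpBounded fun (_ : ℝ) (x : Hat E) => ext l x :=
  ⟨1, _, zero_le_one, fun t ht x => by
    rw [one_mul]
    refine le_trans ?_ (exp_norm_ext_le_expBound l x)
    linarith [Real.add_one_le_exp ‖OecklQuantization.ext l x‖]⟩

theorem exp_ext (l : E →L[ℝ] ℂ) : IsExpBounded fun (_ : ℝ) (x : Hat E) =>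
    Complex.exp (OecklQuantization.ext l x) :=
  ⟨1, _, zero_le_one, fun t ht x => by
    rw [one_mul]
    exact (Complex.norm_exp_le_exp_norm _).trans (exp_norm_ext_le_expBound l x)⟩

theorem exp_param_mul_ext (l : E →L[ℝ] ℂ) : IsExpBounded fun (t : ℝ) (x : Hat E) =>
    Complex.exp (t * OecklQuantization.ext l x) :=
  ⟨1, _, zero_le_one, fun t ht x => by
    rw [one_mul]
    refine (Complex.norm_exp_le_exp_norm _).trans (le_trans ?_ (exp_norm_ext_le_expBound l x))
    rw [norm_mul, Complex.norm_real, Real.norm_eq_abs]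
    exact Real.exp_le_exp.2 (mul_le_of_le_one_left (norm_nonneg _) ht)⟩

theorem exp_param_mul (c : ℂ) : IsExpBounded fun (t : ℝ) (_ : Hat E) => Complex.exp (t * c) :=
  ⟨Real.exp ‖c‖, [], by positivity, fun t ht x => by
    rw [expBound_nil, mul_one]
    refine (Complex.norm_exp_le_exp_norm _).trans ?_
    rw [norm_mul, Complex.norm_real, Real.norm_eq_abs]
    exact Real.exp_le_exp.2 (mul_le_of_le_one_left (norm_nonneg _) ht)⟩

theorem integrable {Φ : ℝ → Hat E → ℂ} (h : IsExpBounded Φ) {ν : Measure (Hat E)} {v : ℝ≥0}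
    (hν : IsHatGaussian ν v) (hm : Measurable (Φ 0)) : Integrable (Φ 0) ν := by
  obtain ⟨C, s, hC, h⟩ := h
  exact ((hν.integrable_expBound s).const_mul C).mono' hm.aestronglyMeasurable
    (ae_of_all _ fun x => h 0 (by simp) x)

theorem memLp_two {Φ : ℝ → Hat E → ℂ} (h : IsExpBounded Φ) {ν : Measure (Hat E)} {v : ℝ≥0}
    (hν : IsHatGaussian ν v) (hm : Measurable (Φ 0)) : MemLp (Φ 0) 2 ν := by
  rw [memLp_two_iff_integrable_sq_norm hm.aestronglyMeasurable]
  have h1 := ((h.mul h).integrable hν (hm.mul hm)).norm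
  simpa [pow_two] using h1

end IsExpBounded

namespace IsExpPoly

theorem zero : IsExpPoly (0 : Hat E → ℂ) := by
  simpa using! const_mul 0 (exp (0 : E →L[ℝ] ℂ) 0)

theorem measurable {ψ : Hat E → ℂ} (hψ : IsExpPoly ψ) : Measurable ψ := by
  induction hψ with
  | exp l c => exact Complex.measurable_exp.comp ((measurable_ext l).add_const c)
  | ext_mul l _ ih => exact (measurable_ext l).mul ih
  | add _ _ h1 h2 => exact h1.add h2
  | const_mul c _ ih => exact ih.const_mul c

theorem isExpBounded_translate {ψ : Hat E → ℂ} (hψ : IsExpPoly ψ) (y : Hat E) :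
    IsExpBounded fun t x => ψ (x + t • y) := by
  have hl : ∀ l : E →L[ℝ] ℂ, IsExpBounded fun t (x : Hat E) => ext l (x + t • y) := fun l => by
    simp only [ext_add_right, ext_smul_right]
    exact (IsExpBounded.ext l).add (IsExpBounded.param.mul (.const _))
  induction hψ with
  | exp l c =>
    simp only [ext_add_right, ext_smul_right, Complex.exp_add]
    exact ((IsExpBounded.exp_ext l).mul (.exp_param_mul _)).mul (.const _)
  | ext_mul l _ ih => exact (hl l).mul ih
  | add _ _ h1 h2 => exact h1.add h2
  | const_mul c _ ih => exact (IsExpBounded.const c).mul ih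

theorem isExpBounded {ψ : Hat E → ℂ} (hψ : IsExpPoly ψ) : IsExpBounded fun _ x => ψ x := by
  simpa using hψ.isExpBounded_translate 0

theorem memLp {ψ : Hat E → ℂ} (hψ : IsExpPoly ψ) {ν : Measure (Hat E)} {v : ℝ≥0}
    (hν : IsHatGaussian ν v) : MemLp ψ 2 ν :=
  hψ.isExpBounded.memLp_two hν hψ.measurable

/-- The derivative is produced by the product and chain rules inside the class, and only afterwards
identified with `lineDeriv`. -/
theorem exists_hasDerivAt {ψ : Hat E → ℂ} (hψ : IsExpPoly ψ) (y : Hat E) :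
    ∃ ψ' : Hat E → ℂ, IsExpPoly ψ' ∧
      ∀ x (t : ℝ), HasDerivAt (fun t : ℝ => ψ (x + t • y)) (ψ' (x + t • y)) t := by
  have hl : ∀ (l : E →L[ℝ] ℂ) (x : Hat E) (t : ℝ),
      HasDerivAt (fun t : ℝ => ext l (x + t • y)) (ext l y) t := fun l x t => by
    simp only [ext_add_right, ext_smul_right]
    simpa using (((hasDerivAt_id t).ofReal_comp).mul_const (ext l y)).const_add (ext l x)
  induction hψ with
  | exp l c =>
    refine ⟨fun x => ext l y * Complex.exp (ext l x + c), const_mul _ (exp l c), fun x t => ?_⟩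
    simp only [mul_comm (ext l y)]
    exact ((hl l x t).add_const c).cexp
  | ext_mul l hψ ih =>
    obtain ⟨ψ', h1, h2⟩ := ih
    refine ⟨fun x => ext l y * _ + ext l x * ψ' x, add (const_mul _ hψ) (ext_mul l h1),
      fun x t => ?_⟩
    exact (hl l x t).mul (h2 x t)
  | add _ _ ih1 ih2 =>
    obtain ⟨ψ', h1, h2⟩ := ih1
    obtain ⟨χ', h3, h4⟩ := ih2
    exact ⟨_, add h1 h3, fun x t => (h2 x t).add (h4 x t)⟩
  | const_mul c _ ih =>
    obtain ⟨ψ', h1, h2⟩ := ih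
    exact ⟨_, const_mul c h1, fun x t => (h2 x t).const_mul c⟩

theorem lineDeriv {ψ : Hat E → ℂ} (hψ : IsExpPoly ψ) (y : Hat E) :
    IsExpPoly fun x => lineDeriv ℝ ψ x y := by
  obtain ⟨ψ', h1, h⟩ := hψ.exists_hasDerivAt y
  convert h1 using 2 with x
  have h2 := (h x 0).deriv
  rw [zero_smul, add_zero] at h2
  exact h2

theorem hasDerivAt {ψ : Hat E → ℂ} (hψ : IsExpPoly ψ) (x y : Hat E) (t : ℝ) :
    HasDerivAt (fun t : ℝ => ψ (x + t • y)) (_root_.lineDeriv ℝ ψ (x + t • y) y) t := by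
  obtain ⟨ψ', h1, h⟩ := hψ.exists_hasDerivAt y
  convert h x t
  have h2 := (h (x + t • y) 0).deriv
  rw [zero_smul, add_zero] at h2
  exact h2

theorem lineDeriv_add {ψ χ : Hat E → ℂ} (hψ : IsExpPoly ψ) (hχ : IsExpPoly χ) (x y : Hat E) :
    _root_.lineDeriv ℝ (ψ + χ) x y = _root_.lineDeriv ℝ ψ x y + _root_.lineDeriv ℝ χ x y := by
  have h := ((hψ.hasDerivAt x y 0).add (hχ.hasDerivAt x y 0)).deriv
  rw [zero_smul, add_zero] at h
  exact h

/-- Differentiation under the Gaussian integral. -/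
theorem hasDerivAt_integral {ψ : Hat E → ℂ} (hψ : IsExpPoly ψ) {κ : Hat E → ℂ}
    (hκ : IsExpBounded fun _ x => κ x) (hκm : Measurable κ) {ν : Measure (Hat E)} {v : ℝ≥0}
    (hν : IsHatGaussian ν v) (l : E →L[ℝ] ℂ) (y : Hat E) :
    HasDerivAt (fun t : ℝ => ∫ x, κ x * (Complex.exp (t * ext l x) * ψ (x + t • y)) ∂ν)
      (∫ x, κ x * (ext l x * ψ x + _root_.lineDeriv ℝ ψ x y) ∂ν) 0 := by
  have htr : ∀ t : ℝ, Measurable fun x : Hat E => x + t • y := fun t => measurable_toHat fun f => by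
    simpa using (measurable_eval f).add_const _
  have hem : ∀ t : ℝ, Measurable fun x : Hat E => Complex.exp (t * ext l x) := fun t =>
    Complex.measurable_exp.comp ((measurable_ext l).const_mul _)
  have hFm : ∀ t : ℝ, Measurable fun x => κ x * (Complex.exp (t * ext l x) * ψ (x + t • y)) :=
    fun t => hκm.mul ((hem t).mul (hψ.measurable.comp (htr t)))
  have hF : IsExpBounded fun (t : ℝ) x => κ x * (Complex.exp (t * ext l x) * ψ (x + t • y)) :=
    hκ.mul ((IsExpBounded.exp_param_mul_ext l).mul (hψ.isExpBounded_translate y))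
  -- The derivative of the integrand in `t`. For `|t| ≤ 1` it is dominated by a multiple of
  -- `expBound s`, independent of `t` and integrable.
  let F' : ℝ → Hat E → ℂ := fun t x => κ x * (Complex.exp (t * ext l x) * ext l x * ψ (x + t • y)
    + Complex.exp (t * ext l x) * _root_.lineDeriv ℝ ψ (x + t • y) y)
  have hF'm : Measurable (F' 0) := hκm.mul ((((hem 0).mul (measurable_ext l)).mul
    (hψ.measurable.comp (htr 0))).add ((hem 0).mul ((hψ.lineDeriv y).measurable.comp (htr 0))))
  have hF' : IsExpBounded F' := hκ.mul
    ((((IsExpBounded.exp_param_mul_ext l).mul (.ext l)).mul (hψ.isExpBounded_translate y)).add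
      ((IsExpBounded.exp_param_mul_ext l).mul ((hψ.lineDeriv y).isExpBounded_translate y)))
  obtain ⟨C, s, hC, hb⟩ := hF'
  have key := (hasDerivAt_integral_of_dominated_loc_of_deriv_le (μ := ν) (x₀ := (0 : ℝ))
    (s := Metric.ball 0 1) (F' := F') (bound := fun x => C * expBound s x)
    (F := fun (t : ℝ) x => κ x * (Complex.exp (t * ext l x) * ψ (x + t • y)))
    (Metric.ball_mem_nhds 0 one_pos) (Eventually.of_forall fun t => (hFm t).aestronglyMeasurable)
    (hF.integrable hν (hFm 0)) hF'm.aestronglyMeasurable (ae_of_all _ fun x t ht => hb t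
      (by simpa using (mem_ball_zero_iff.1 ht).le) x)
    ((hν.integrable_expBound s).const_mul C) (ae_of_all _ fun x t _ => ?_)).2
  · convert key using 1
    congr with x
    simp [F']
  · refine HasDerivAt.const_mul _ (HasDerivAt.mul ?_ (hψ.hasDerivAt x y t))
    simpa using (((hasDerivAt_id t).ofReal_comp).mul_const (ext l x)).cexp

end IsExpPoly
end expPoly
-- Schrödinger quantization on the functions generated from coherent states.
namespace FieldTheory

variable {L : Type*} [NormedAddCommGroup L] [InnerProductSpace ℝ L] (T : FieldTheory L)
  [CompleteSpace L]

/-- Exhibits the operator as `i` times the generator of `ψ ↦ e^{tA} ψ(· - t qX)`, with `A`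
multiplication by the exponent of `k_X`. -/
theorem schrQuant_apply (F : StrongDual ℝ L) (ψ : Hat T.Q → ℂ) (φ : Hat T.Q) :
    T.schrQuant F ψ φ = Complex.I * (ext (T.schrExponent (T.ham F)) φ * ψ φ
      - lineDeriv ℝ ψ φ (incl (T.q (T.ham F)))) := by
  have h : -Complex.ofRealCLM.comp (T.bracketQ (T.ham F)) + Complex.I • T.Omega (T.q (T.ham F))
      = Complex.I • T.schrExponent (T.ham F) := by
    ext φ
    simp only [schrExponent, add_apply, neg_apply, FunLike.coe_smul, Pi.smul_apply,
      ContinuousLinearMap.comp_apply, Complex.ofRealCLM_apply, smul_eq_mul]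
    linear_combination -(T.bracketQ (T.ham F) φ : ℂ) * Complex.I_sq
  rw [schrQuant, h, ext_smul]
  ring

theorem isExpPoly_schrCoherent (τ : L) : IsExpPoly (T.schrCoherent τ) := IsExpPoly.exp _ _

theorem isExpPoly_schrQuant (F : StrongDual ℝ L) {ψ : Hat T.Q → ℂ} (hψ : IsExpPoly ψ) :
    IsExpPoly (T.schrQuant F ψ) := by
  have h := IsExpPoly.const_mul Complex.I ((IsExpPoly.ext_mul (T.schrExponent (T.ham F)) hψ).add
    (IsExpPoly.const_mul (-1) (hψ.lineDeriv (incl (T.q (T.ham F))))))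
  convert h using 2 with φ
  rw [schrQuant_apply]
  ring

/-- Additivity of the directional derivative needs differentiability, which membership in the class
provides. -/
theorem schrQuant_add (F : StrongDual ℝ L) {ψ χ : Hat T.Q → ℂ} (hψ : IsExpPoly ψ)
    (hχ : IsExpPoly χ) : T.schrQuant F (ψ + χ) = T.schrQuant F ψ + T.schrQuant F χ := by
  funext φ
  simp only [schrQuant_apply, Pi.add_apply,
    hψ.lineDeriv_add hχ]
  ring

theorem schrQuant_smul (F : StrongDual ℝ L) (c : ℂ) (ψ : Hat T.Q → ℂ) :
    T.schrQuant F (c • ψ) = c • T.schrQuant F ψ := by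
  funext φ
  have h : ∀ y, lineDeriv ℝ (c • ψ) φ y = c * lineDeriv ℝ ψ φ y := fun y =>
    deriv_const_mul_field c
  simp only [schrQuant_apply, Pi.smul_apply, h, smul_eq_mul]
  ring

theorem isExpPoly_of_mem {ψ : Hat T.Q → ℂ} (hψ : ψ ∈ T.schrCPFun) : IsExpPoly ψ := by
  induction hψ using Submodule.span_induction with
  | mem ψ hψ =>
    obtain ⟨⟨s, τ⟩, rfl⟩ := hψ
    induction s with
    | nil => exact T.isExpPoly_schrCoherent τ
    | cons F s ih => exact T.isExpPoly_schrQuant F ih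
  | zero => exact IsExpPoly.zero
  | add ψ χ _ _ h1 h2 => exact h1.add h2
  | smul c ψ _ h => exact h.const_mul c

theorem schrQuant_mem (F : StrongDual ℝ L) {ψ : Hat T.Q → ℂ} (hψ : ψ ∈ T.schrCPFun) :
    T.schrQuant F ψ ∈ T.schrCPFun := by
  induction hψ using Submodule.span_induction with
  | mem ψ hψ =>
    obtain ⟨⟨s, τ⟩, rfl⟩ := hψ
    exact Submodule.subset_span ⟨(F :: s, τ), rfl⟩
  | zero =>
    have h := T.schrQuant_smul F 0 0
    rw [zero_smul, zero_smul] at h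
    rw [h]
    exact zero_mem _
  | add ψ χ h1 h2 h3 h4 =>
    rw [T.schrQuant_add F (T.isExpPoly_of_mem h1) (T.isExpPoly_of_mem h2)]
    exact add_mem h3 h4
  | smul c ψ _ h2 =>
    rw [T.schrQuant_smul F c]
    exact Submodule.smul_mem _ c h2

/-- Quantized observables on the reduced Schrödinger wave functions in `schrCPFun`. -/
def schrQuantCP (F : StrongDual ℝ L) : Module.End ℂ T.schrCPFun where
  toFun ψ := ⟨T.schrQuant F ψ, T.schrQuant_mem F ψ.2⟩
  map_add' ψ χ := Subtype.ext
    (T.schrQuant_add F (T.isExpPoly_of_mem ψ.2) (T.isExpPoly_of_mem χ.2))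
  map_smul' c ψ := Subtype.ext (T.schrQuant_smul F c ψ)

theorem memLp_of_mem {ψ : Hat T.Q → ℂ} (hψ : ψ ∈ T.schrCPFun) : MemLp ψ 2 T.nuQ :=
  (T.isExpPoly_of_mem hψ).memLp T.isHatGaussian_nuQ

/-- The state given by a wave function in `schrCPFun`. -/
def schrState : T.schrCPFun →ₗ[ℂ] T.HS where
  toFun ψ := (T.memLp_of_mem ψ.2).toLp
  map_add' _ _ := MemLp.toLp_add _ _
  map_smul' c _ := MemLp.toLp_const_smul c _

theorem schrState_ae_eq (ψ : T.schrCPFun) : T.schrState ψ =ᵐ[T.nuQ] (ψ : Hat T.Q → ℂ) :=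
  (T.memLp_of_mem ψ.2).coeFn_toLp

theorem inner_schrCoherentState_schrState (τ : L) (ψ : T.schrCPFun) :
    ⟪T.schrCoherentState τ, T.schrState ψ⟫_ℂ
      = ∫ φ, (starRingEnd ℂ) (T.schrCoherent τ φ) * (ψ : Hat T.Q → ℂ) φ ∂T.nuQ := by
  rw [inner_schrCoherentState]
  refine integral_congr_ae ?_
  filter_upwards [T.schrState_ae_eq ψ] with φ hφ
  rw [hφ]

/-- The antisymmetric part of the bracket is `ω`, which vanishes on `JM`. -/
theorem Omega_symm (φ φ' : T.Q) : T.Omega φ φ' = T.Omega φ' φ := by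
  have h := T.inner_J_of_mem_JM (T.j_mem φ) (T.j_mem φ')
  rw [inner_J_left, omega_apply, ← T.bracketQ_q, ← T.bracketQ_q, q_j, q_j] at h
  rw [Omega_apply, Omega_apply, real_inner_comm]
  congr 3
  linarith

theorem schrExponent_apply_q (τ ξ : L) :
    T.schrExponent τ (T.q ξ) = T.Omega (T.q τ) (T.q ξ) + Complex.I * T.bracket τ ξ := by
  rw [schrExponent, add_apply]
  rfl

theorem schrConst_sub_smul (σ X : L) (t : ℝ) : T.schrConst (σ - t • X) = T.schrConst σ
    + t * (T.Omega (T.q σ) (T.q X) + Complex.I / 2 * (T.bracket σ X + T.bracket X σ))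
    + t ^ 2 * T.schrConst X := by
  have h := T.Omega_symm (T.q X) (T.q σ)
  simp only [Omega_apply] at h
  simp only [schrConst, Omega_apply]
  have hq : T.q (σ - t • X) = T.q σ - t • T.q X := rfl
  rw [hq]
  simp only [map_sub, map_smul, bracketQ_q, inner_sub_left, inner_sub_right, real_inner_smul_left, real_inner_smul_right,
     sub_apply, FunLike.coe_smul, Pi.smul_apply, smul_eq_mul] at h ⊢
  push_cast
  linear_combination (t / 2 : ℂ) * h

theorem schrRe_sub_smul (σ X : L) (t : ℝ) :
    T.schrRe (σ - t • X) = T.schrRe σ - t • T.schrRe X := by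
  have hq : T.q (σ - t • X) = T.q σ - t • T.q X := rfl
  simp only [schrRe, hq, map_sub, map_smul, ContinuousLinearMap.sub_comp,
    ContinuousLinearMap.smul_comp]

theorem schrIm_sub_smul (σ X : L) (t : ℝ) :
    T.schrIm (σ - t • X) = T.schrIm σ - t • T.schrIm X := by
  ext φ
  obtain ⟨ξ, rfl⟩ := T.M.mkQ_surjective φ
  have hq : T.q (σ - t • X) = T.q σ - t • T.q X := rfl
  change T.schrIm _ (T.q ξ) = T.schrIm _ (T.q ξ) - t * T.schrIm _ (T.q ξ)
  simp only [schrIm_apply_q, hq, map_sub, map_smul, inner_sub_left, real_inner_smul_left]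
  ring

/-- The translate of a coherent state by the Cameron–Martin formula. -/
theorem integral_conj_schrCoherent_mul_translate (σ X : L) (t : ℝ) {ψ : Hat T.Q → ℂ}
    (hψ : Measurable ψ) :
    ∫ φ, (starRingEnd ℂ) (T.schrCoherent σ φ) * (Complex.exp (t * ext (T.schrExponent X) φ)
        * ψ (φ + t • -incl (T.q X))) ∂T.nuQ
      = Complex.exp (-(Complex.I * T.omega σ X * t) + t ^ 2 * (T.schrExponent X (T.q X)
          - ‖T.j (T.q X)‖ ^ 2 - (starRingEnd ℂ) (T.schrConst X)))
        * ∫ φ, (starRingEnd ℂ) (T.schrCoherent (σ - t • X) φ) * ψ φ ∂T.nuQ := by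
  let y : Hat T.Q := t • -incl (T.q X)
  -- As `nuQ` has variance `1 / 2`, the factor `-2t` is what makes the Cameron–Martin shift of `a`
  -- equal to `-t qX`.
  let a : StrongDual ℝ T.Q := -(2 * t) • T.schrRe X
  have hy : ∀ b, y b = (1 / 2 : ℝ≥0) * ⟪T.dualEmbedding a, T.dualEmbedding b⟫_ℝ := fun b => by
    have h1 : T.dualEmbedding a = -(2 * t) • T.j (T.q X) := by
      rw [← dualEmbedding_schrRe, ← T.dualEmbedding.map_smul]
    have h2 : y b = t * -b (T.q X) := rfl
    rw [h1, inner_smul_left, real_inner_comm, inner_dualEmbedding, q_j, h2]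
    simp
    ring
  -- The integrand before translation: `G (φ + y)` is the integrand on the left-hand side. The shift
  -- thus falls on the coherent state, and completing the exponents gives `k_{σ - tX}`.
  let G : Hat T.Q → ℂ := fun φ => (starRingEnd ℂ) (T.schrCoherent σ (φ - y))
    * (Complex.exp (t * ext (T.schrExponent X) (φ - y)) * ψ φ)
  have hsub : Measurable fun φ : Hat T.Q => φ - y := measurable_toHat fun f => by
    simpa using (measurable_eval f).sub_const (y f)
  have hG : Measurable G := (Complex.continuous_conj.measurable.comp
    ((T.isExpPoly_schrCoherent σ).measurable.comp hsub)).mul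
    ((Complex.measurable_exp.comp (((measurable_ext _).comp hsub).const_mul _)).mul hψ)
  have h := T.isHatGaussian_nuQ.integral_add T.dualEmbedding a y hy hG
  simp only [G, add_sub_cancel_right] at h
  rw [h, ← integral_const_mul]
  congr with φ
  rw [schrCoherent_apply, schrCoherent_apply, ← Complex.exp_conj, ← Complex.exp_conj,
    ← mul_assoc _ (Complex.exp _) (ψ φ), ← Complex.exp_add, ← mul_assoc, ← Complex.exp_add,
    ← mul_assoc, ← Complex.exp_add]
  congr 2
  have hy2 : φ - y = φ + t • incl (T.q X) := by simp [y]
  have ha : ‖a‖ ^ 2 = (2 * t) ^ 2 * ‖T.j (T.q X)‖ ^ 2 := by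
    rw [← T.dualEmbedding.norm_map a, T.dualEmbedding.map_smul, dualEmbedding_schrRe, norm_smul,
      mul_pow, Real.norm_eq_abs, sq_abs]
    ring
  have ha2 : φ a = -(2 * t) * φ (T.schrRe X) := by simp [a]
  rw [hy2, ha2, schrConst_sub_smul]
  simp only [ext_add_right, ext_smul_right, ext_incl]
  rw [ext_schrExponent, ext_schrExponent, ext_schrExponent, schrRe_sub_smul, schrIm_sub_smul,
    schrExponent_apply_q, schrExponent_apply_q, omega_apply]
  have ha' : (‖a‖ : ℂ) ^ 2 = (2 * t) ^ 2 * ‖T.j (T.q X)‖ ^ 2 := mod_cast ha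
  rw [ha']
  simp only [map_add, map_sub, map_mul, map_smul, smul_eq_mul, Complex.conj_ofReal, Complex.conj_I,
    map_div₀, Complex.conj_ofNat, map_pow]
  push_cast
  ring

end FieldTheory
-- Intertwining of the two quantizations.
namespace FieldTheory

variable {L : Type*} [NormedAddCommGroup L] [InnerProductSpace ℝ L] (T : FieldTheory L)
  [CompleteSpace L]

theorem inner_schrCoherentState_eq {B : T.HS ≃ₗᵢ[ℂ] T.HH}
    (hB : ∀ τ, B (T.schrCoherentState τ) = T.holNormalizedState τ) (τ : L) (u : T.HS) :
    ⟪T.schrCoherentState τ, u⟫_ℂ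
      = Complex.exp (-(1 / 4) * (‖τ‖ ^ 2 : ℝ)) * T.wave (B u) τ := by
  rw [← B.inner_map_map, hB, inner_holNormalizedState, wave_apply]

/-- By holomorphy `D_{JX} = i D_X`, so the complex field `X_{F⁻}` acts on wave functions simply as
`D_X`. The sign in the first claim comes from moving along `σ - tX`. -/
theorem hasDerivAt_wave (u : T.HH) (σ X : L) :
    ∃ d : ℂ, HasDerivAt (fun t : ℝ => T.wave u (σ - t • X)) (-d) 0 ∧
      lineDeriv ℝ (T.wave u) σ X = d ∧ lineDeriv ℝ (T.wave u) σ (T.J X) = Complex.I * d := by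
  have hd := (T.differentiable_wave u σ X 0).hasDerivAt
  set d := deriv (fun z : ℂ => T.wave u (σ + T.cmul z X)) 0
  have hc : ∀ c : ℂ, HasDerivAt (fun t : ℝ => T.wave u (σ + t • T.cmul c X)) (c * d) 0 := fun c => by
    have h1 : HasDerivAt (fun t : ℝ => (t : ℂ) * c) c 0 := by
      simpa using ((hasDerivAt_id (0 : ℝ)).ofReal_comp).mul_const c
    have h2 := HasDerivAt.comp (h₂ := fun z : ℂ => T.wave u (σ + T.cmul z X)) (h₂' := d)
      (h := fun t : ℝ => (t : ℂ) * c) (0 : ℝ) (by simpa using hd) h1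
    rw [mul_comm d c] at h2
    refine h2.congr_of_eventuallyEq (Eventually.of_forall fun t => ?_)
    simp only [Function.comp, cmul_cmul]
    simp [cmul_apply T (t : ℂ)]
  have h1 : T.cmul 1 X = X := by simp [cmul_apply]
  have hI : T.cmul Complex.I X = T.J X := by simp [cmul_apply]
  have hm : T.cmul (-1) X = -X := by simp [cmul_apply]
  refine ⟨d, ?_, ?_, ?_⟩
  · have := hc (-1)
    rw [hm] at this
    simpa [sub_eq_add_neg] using this
  · have := (hc 1).deriv
    rw [h1, one_mul] at this
    exact this
  · have := (hc Complex.I).deriv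
    rw [hI] at this
    exact this

theorem holPart_eq (F : StrongDual ℝ L) (σ : L) : T.holPart F σ
    = T.omega σ (T.ham F) + Complex.I / 2 * ⟪σ, T.ham F⟫_ℝ := by
  rw [holPart, ← T.two_mul_omega_ham F σ, ← T.two_mul_omega_ham F (T.J σ), ← T.inner_J_left (T.J σ),
    T.J_sq, inner_neg_left]
  push_cast
  ring

/-- The isomorphism intertwines the two quantizations. -/
theorem wave_schrQuantCP {B : T.HS ≃ₗᵢ[ℂ] T.HH}
    (hB : ∀ τ, B (T.schrCoherentState τ) = T.holNormalizedState τ) (F : StrongDual ℝ L)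
    (ψ : T.schrCPFun) : T.wave (B (T.schrState (T.schrQuantCP F ψ)))
      = T.holQuant F (T.wave (B (T.schrState ψ))) := by
  funext σ
  set X := T.ham F with hX
  set u := B (T.schrState ψ)
  have hψ := T.isExpPoly_of_mem ψ.2
  obtain ⟨d, hd, hd1, hd2⟩ := T.hasDerivAt_wave u σ X
  have hκ : IsExpBounded fun (_ : ℝ) φ => (starRingEnd ℂ) (T.schrCoherent σ φ) := by
    obtain ⟨C, s, hC, h⟩ := (T.isExpPoly_schrCoherent σ).isExpBounded
    exact ⟨C, s, hC, fun t ht x => by rw [RCLike.norm_conj]; exact h t ht x⟩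
  have hκm : Measurable fun φ => (starRingEnd ℂ) (T.schrCoherent σ φ) :=
    Complex.continuous_conj.measurable.comp (T.isExpPoly_schrCoherent σ).measurable
  -- The pairing of `k_σ` with `e^{tA} ψ(· - t qX)` is differentiated at `t = 0` in two ways: under
  -- the integral, which yields `-i` times the pairing with `F̌ψ`, and through the translated
  -- coherent state.
  have hder := hψ.hasDerivAt_integral hκ hκm T.isHatGaussian_nuQ (T.schrExponent X)
    (-incl (T.q X))
  have hint : ∀ t : ℝ, ∫ φ, (starRingEnd ℂ) (T.schrCoherent (σ - t • X) φ)
      * (ψ : Hat T.Q → ℂ) φ ∂T.nuQ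
      = Complex.exp (-(1 / 4) * (‖σ - t • X‖ ^ 2 : ℝ)) * T.wave u (σ - t • X) := fun t => by
    rw [← inner_schrCoherentState_schrState, T.inner_schrCoherentState_eq hB]
  simp only [T.integral_conj_schrCoherent_mul_translate σ X _ hψ.measurable, hint] at hder
  have hlhs : ∫ φ, (starRingEnd ℂ) (T.schrCoherent σ φ)
      * (ext (T.schrExponent X) φ * (ψ : Hat T.Q → ℂ) φ
        + lineDeriv ℝ (ψ : Hat T.Q → ℂ) φ (-incl (T.q X))) ∂T.nuQ
      = -Complex.I * (Complex.exp (-(1 / 4) * (‖σ‖ ^ 2 : ℝ))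
        * T.wave (B (T.schrState (T.schrQuantCP F ψ))) σ) := by
    rw [← T.inner_schrCoherentState_eq hB, inner_schrCoherentState_schrState, ← integral_const_mul]
    congr with φ
    change _ = -Complex.I * (_ * T.schrQuant F ψ φ)
    rw [schrQuant_apply, lineDeriv_neg]
    linear_combination ((starRingEnd ℂ) (T.schrCoherent σ φ) * (ext (T.schrExponent X) φ *
      (ψ : Hat T.Q → ℂ) φ - lineDeriv ℝ (ψ : Hat T.Q → ℂ) φ (incl (T.q X)))) * Complex.I_sq
  rw [hlhs] at hder
  -- This constant enters only with `t²`, so it does not affect the derivative at `0`.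
  generalize T.schrExponent X (T.q X) - ‖T.j (T.q X)‖ ^ 2 - (starRingEnd ℂ) (T.schrConst X) = κ
    at hder
  have hid : HasDerivAt (fun t : ℝ => (t : ℂ)) 1 0 := (hasDerivAt_id (0 : ℝ)).ofReal_comp
  have hE : HasDerivAt (fun t : ℝ => Complex.exp (-(Complex.I * T.omega σ X * t) + t ^ 2 * κ))
      (-(Complex.I * T.omega σ X)) 0 := by
    have := (((hid.const_mul (Complex.I * T.omega σ X)).neg).add ((hid.pow 2).mul_const κ)).cexp
    simpa using this
  have hN : HasDerivAt (fun t : ℝ => Complex.exp (-(1 / 4) * (‖σ - t • X‖ ^ 2 : ℝ)))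
      (Complex.exp (-(1 / 4) * (‖σ‖ ^ 2 : ℝ)) * (1 / 2 * ⟪σ, X⟫_ℝ)) 0 := by
    have h1 : ∀ t : ℝ, ((‖σ - t • X‖ ^ 2 : ℝ) : ℂ)
        = (‖σ‖ ^ 2 : ℝ) - 2 * (⟪σ, X⟫_ℝ * t) + t ^ 2 * (‖X‖ ^ 2 : ℝ) := fun t => by
      rw [norm_sub_sq_real, real_inner_smul_right, norm_smul, mul_pow, Real.norm_eq_abs, sq_abs]
      push_cast
      ring
    simp only [h1]
    have := (((((hid.const_mul (⟪σ, X⟫_ℝ : ℂ)).const_mul 2).const_sub ((‖σ‖ ^ 2 : ℝ) : ℂ)).add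
      ((hid.pow 2).mul_const ((‖X‖ ^ 2 : ℝ) : ℂ))).const_mul (-(1 / 4) : ℂ)).cexp
    convert this using 1
    simp only [Pi.add_apply, Pi.pow_apply]
    simp
    ring
  have h2 := hder.unique (hE.mul (hN.mul hd))
  simp only [zero_smul, sub_zero, Complex.ofReal_zero, mul_zero, neg_zero, ne_eq, OfNat.ofNat_ne_zero,
    not_false_eq_true, zero_pow, zero_mul, add_zero, Complex.exp_zero, one_mul] at h2
  have hne := Complex.exp_ne_zero (-(1 / 4) * (‖σ‖ ^ 2 : ℝ))
  generalize Complex.exp (-(1 / 4) * (‖σ‖ ^ 2 : ℝ)) = e at h2 hne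
  have h3 : -Complex.I * T.wave (B (T.schrState (T.schrQuantCP F ψ))) σ
      = (-(Complex.I * T.omega σ X) + 1 / 2 * ⟪σ, X⟫_ℝ) * T.wave u σ - d := by
    refine mul_left_cancel₀ hne ?_
    linear_combination h2
  rw [holQuant, ← hX, hd1, hd2, holPart_eq, ← hX]
  linear_combination Complex.I * h3 + (T.wave (B (T.schrState (T.schrQuantCP F ψ))) σ - Complex.I * d / 2
    - T.omega σ X * T.wave u σ) * Complex.I_sq

end FieldTheory
-- The coherent-state domains and the operators on them.
namespace FieldTheory

variable {L : Type*} [NormedAddCommGroup L] [InnerProductSpace ℝ L] (T : FieldTheory L)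
  [CompleteSpace L]

theorem holQuant_smul (F : StrongDual ℝ L) (c : ℂ) (ψ : L → ℂ) :
    T.holQuant F (c • ψ) = c • T.holQuant F ψ := by
  funext ξ
  have h : ∀ y, lineDeriv ℝ (c • ψ) ξ y = c * lineDeriv ℝ ψ ξ y := fun y =>
    deriv_const_mul_field c
  simp only [holQuant, Pi.smul_apply, h, smul_eq_mul]
  ring

theorem wave_holNormalizedState (τ : L) :
    T.wave (T.holNormalizedState τ)
      = Complex.exp (-(1 / 4) * (⟪τ, τ⟫_ℝ : ℂ)) • T.holCoherent τ := by
  rw [holNormalizedState, map_smul]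
  congr 1
  funext σ
  exact T.inner_holCoherentLp_holCoherentLp σ τ

theorem foldr_schrQuant_mem (s : List (StrongDual ℝ L)) (τ : L) :
    s.foldr T.schrQuant (T.schrCoherent τ) ∈ T.schrCPFun :=
  Submodule.subset_span ⟨(s, τ), rfl⟩


/-- Intertwining is applied one observable at a time; the normalization of the coherent state is a
scalar and passes through. Both domains thus have matching generators up to nonzero factors. -/
theorem wave_foldr {B : T.HS ≃ₗᵢ[ℂ] T.HH}
    (hB : ∀ τ, B (T.schrCoherentState τ) = T.holNormalizedState τ) (s : List (StrongDual ℝ L)) (τ : L) :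
    T.wave (B (T.schrState ⟨_, T.foldr_schrQuant_mem s τ⟩))
      = Complex.exp (-(1 / 4) * (⟪τ, τ⟫_ℝ : ℂ)) • s.foldr T.holQuant (T.holCoherent τ) := by
  induction s with
  | nil =>
    exact (congrArg T.wave (hB τ)).trans (T.wave_holNormalizedState τ)
  | cons F s ih =>
    refine (T.wave_schrQuantCP hB F ⟨_, T.foldr_schrQuant_mem s τ⟩).trans ?_
    rw [ih, holQuant_smul]
    rfl

theorem exists_schrState_of_mem {B : T.HS ≃ₗᵢ[ℂ] T.HH}
    (hB : ∀ τ, B (T.schrCoherentState τ) = T.holNormalizedState τ) {χ : L → ℂ} (hχ : χ ∈ T.holCPFun) :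
    ∃ ψ, T.wave (B (T.schrState ψ)) = χ := by
  induction hχ using Submodule.span_induction with
  | mem χ hχ =>
    obtain ⟨⟨s, τ⟩, rfl⟩ := hχ
    refine ⟨(Complex.exp (-(1 / 4) * (⟪τ, τ⟫_ℝ : ℂ)))⁻¹ • ⟨_, T.foldr_schrQuant_mem s τ⟩, ?_⟩
    rw [map_smul, map_smul, map_smul, T.wave_foldr hB, smul_smul,
      inv_mul_cancel₀ (Complex.exp_ne_zero _), one_smul]
  | zero => exact ⟨0, by rw [map_zero, map_zero, map_zero]⟩
  | add χ χ' _ _ h h' =>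
    obtain ⟨ψ, rfl⟩ := h
    obtain ⟨ψ', rfl⟩ := h'
    exact ⟨ψ + ψ', by rw [map_add, map_add, map_add]⟩
  | smul c χ _ h =>
    obtain ⟨ψ, rfl⟩ := h
    exact ⟨c • ψ, by rw [map_smul, map_smul, map_smul]⟩

theorem wave_schrState_mem {B : T.HS ≃ₗᵢ[ℂ] T.HH}
    (hB : ∀ τ, B (T.schrCoherentState τ) = T.holNormalizedState τ) (ψ : T.schrCPFun) : T.wave (B (T.schrState ψ)) ∈ T.holCPFun := by
  obtain ⟨ψ, hψ⟩ := ψ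
  induction hψ using Submodule.span_induction with
  | mem ψ hψ =>
    obtain ⟨⟨s, τ⟩, rfl⟩ := hψ
    rw [T.wave_foldr hB]
    exact Submodule.smul_mem _ _ (Submodule.subset_span ⟨(s, τ), rfl⟩)
  | zero =>
    have h : (⟨0, zero_mem _⟩ : T.schrCPFun) = 0 := rfl
    rw [h, map_zero, map_zero, map_zero]
    exact zero_mem _
  | add ψ χ h1 h2 h3 h4 =>
    have h : (⟨ψ + χ, add_mem h1 h2⟩ : T.schrCPFun) = ⟨ψ, h1⟩ + ⟨χ, h2⟩ := rfl
    rw [h, map_add, map_add, map_add]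
    exact add_mem h3 h4
  | smul c ψ h1 h2 =>
    have h : (⟨c • ψ, Submodule.smul_mem _ c h1⟩ : T.schrCPFun) = c • ⟨ψ, h1⟩ := rfl
    rw [h, map_smul, map_smul, map_smul]
    exact Submodule.smul_mem _ c h2

theorem map_HScp {B : T.HS ≃ₗᵢ[ℂ] T.HH}
    (hB : ∀ τ, B (T.schrCoherentState τ) = T.holNormalizedState τ) : T.HScp.map (B.toLinearEquiv : T.HS →ₗ[ℂ] T.HH) = T.HHcp := by
  ext u
  constructor
  · rintro ⟨v, ⟨ψ, hψ, hv⟩, rfl⟩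
    have h : v = T.schrState ⟨ψ, hψ⟩ := Lp.ext (hv.trans (T.schrState_ae_eq ⟨ψ, hψ⟩).symm)
    rw [h]
    exact T.wave_schrState_mem hB _
  · intro hu
    obtain ⟨ψ, hψ⟩ := T.exists_schrState_of_mem hB (Submodule.mem_comap.1 hu)
    exact ⟨T.schrState ψ, ⟨ψ, ψ.2, T.schrState_ae_eq ψ⟩, T.wave_injective hψ⟩

/-- Differentiation acts on functions, not on almost everywhere classes. Independence of the
representative holds because the wave function of the result depends on the state alone, and wave
functions determine states. -/
theorem schrState_schrQuantCP_congr {B : T.HS ≃ₗᵢ[ℂ] T.HH}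
    (hB : ∀ τ, B (T.schrCoherentState τ) = T.holNormalizedState τ) (F : StrongDual ℝ L) {ψ χ : T.schrCPFun}
    (h : T.schrState ψ = T.schrState χ) :
    T.schrState (T.schrQuantCP F ψ) = T.schrState (T.schrQuantCP F χ) := by
  refine B.injective (T.wave_injective ?_)
  rw [T.wave_schrQuantCP hB, T.wave_schrQuantCP hB, h]

/-- The state in `HScp` given by a wave function in `schrCPFun`. -/
def schrStateCP : T.schrCPFun →ₗ[ℂ] T.HScp :=
  T.schrState.codRestrict T.HScp fun ψ => ⟨ψ, ψ.2, T.schrState_ae_eq ψ⟩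

theorem schrStateCP_eq {u : T.HScp} {ψ : Hat T.Q → ℂ} (hψ : ψ ∈ T.schrCPFun)
    (hu : (u : T.HS) =ᵐ[T.nuQ] ψ) : T.schrStateCP ⟨ψ, hψ⟩ = u :=
  Subtype.ext (Lp.ext ((T.schrState_ae_eq ⟨ψ, hψ⟩).trans hu.symm))

theorem range_schrStateCP : LinearMap.range T.schrStateCP = ⊤ :=
  LinearMap.range_eq_top.2 fun u => by
    obtain ⟨ψ, hψ, hu⟩ := u.2
    exact ⟨_, T.schrStateCP_eq hψ hu⟩

end FieldTheory
end
end OecklQuantization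

theorem mainTheorem7 {L : Type*} [NormedAddCommGroup L] [InnerProductSpace ℝ L] [CompleteSpace L]
    [TopologicalSpace.SeparableSpace L] (T : OecklQuantization.FieldTheory L) :
    ∃ B : T.HS ≃ₗᵢ[ℂ] T.HH,
      -- `B` is the unique isometric isomorphism that matches the normalized coherent states
      (∀ τ, B (T.schrCoherentState τ) = T.holNormalizedState τ) ∧
      (∀ B' : T.HS ≃ₗᵢ[ℂ] T.HH,
        (∀ τ, B' (T.schrCoherentState τ) = T.holNormalizedState τ) → B' = B) ∧
      -- all generated functions represent states
      (∀ ψ ∈ T.schrCPFun, MemLp ψ 2 T.nuQ) ∧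
      (∀ ψ ∈ T.holCPFun, ∃ u, T.wave u = ψ) ∧
      -- the quantized observables are well defined operators on the two spaces, and `B`
      -- restricts to an isomorphism that intertwines them
      ∃ (ρS : StrongDual ℝ L → Module.End ℂ T.HScp) (ρH : StrongDual ℝ L → Module.End ℂ T.HHcp)
        (Bcp : T.HScp ≃ₗ[ℂ] T.HHcp),
        (∀ F (u : T.HScp), ∀ ψ ∈ T.schrCPFun, (u : T.HS) =ᵐ[T.nuQ] ψ →
          (ρS F u : T.HS) =ᵐ[T.nuQ] T.schrQuant F ψ) ∧
        (∀ F (u : T.HHcp), T.wave (ρH F u) = T.holQuant F (T.wave u)) ∧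
        (∀ u : T.HScp, (Bcp u : T.HH) = B u) ∧
        ∀ F (u : T.HScp), Bcp (ρS F u) = ρH F (Bcp u) := by
  obtain ⟨B, hB, hBu⟩ := T.exists_isometry
  -- A linear choice of representatives for the states. The operators `ρS` built from it do not
  -- depend on the choice, by `schrState_schrQuantCP_congr`.
  obtain ⟨g, hg⟩ := T.schrStateCP.exists_rightInverse_of_surjective T.range_schrStateCP
  have hg' : ∀ u, T.schrStateCP (g u) = u := fun u => LinearMap.congr_fun hg u
  let ρS : StrongDual ℝ L → Module.End ℂ T.HScp := fun F =>
    T.schrStateCP ∘ₗ T.schrQuantCP F ∘ₗ g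
  let Bcp : T.HScp ≃ₗ[ℂ] T.HHcp := B.toLinearEquiv.ofSubmodules T.HScp T.HHcp (T.map_HScp hB)
  have hBcp : ∀ u : T.HScp, (Bcp u : T.HH) = B u := fun u =>
    LinearEquiv.ofSubmodules_apply B.toLinearEquiv (T.map_HScp hB) u
  -- The operators on the holomorphic side are defined by transport along `Bcp`; that they act by
  -- `holQuant` on wave functions is the intertwining formula.
  refine ⟨B, hB, hBu, fun ψ hψ => T.memLp_of_mem hψ, fun χ hχ => ?_, ρS,
    fun F => Bcp.toLinearMap ∘ₗ ρS F ∘ₗ Bcp.symm.toLinearMap, Bcp, fun F u ψ hψ hu => ?_,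
    fun F u => ?_, hBcp, fun F u => ?_⟩
  · obtain ⟨ψ, hψ⟩ := T.exists_schrState_of_mem hB hχ
    exact ⟨_, hψ⟩
  · have h1 : T.schrState (g u) = T.schrState ⟨ψ, hψ⟩ :=
      congrArg Subtype.val ((hg' u).trans (T.schrStateCP_eq hψ hu).symm)
    have h2 : (ρS F u : T.HS) = T.schrState (T.schrQuantCP F ⟨ψ, hψ⟩) :=
      T.schrState_schrQuantCP_congr hB F h1
    rw [h2]
    exact T.schrState_ae_eq _
  · obtain ⟨v, rfl⟩ := Bcp.surjective u
    change T.wave (Bcp (ρS F (Bcp.symm (Bcp v)))) = _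
    rw [Bcp.symm_apply_apply, hBcp, hBcp]
    have h1 : (v : T.HS) = T.schrState (g v) := congrArg Subtype.val (hg' v).symm
    rw [h1]
    exact T.wave_schrQuantCP hB F (g v)
  · change _ = Bcp (ρS F (Bcp.symm (Bcp u)))
    rw [Bcp.symm_apply_apply]
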